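/- Let $n\ge 1$, let $M\subset\mathbb R^n$ be a bounded open set, $\mu$ Lebesgue measure, and $\lambda,\beta>0$. Let $V$ be a Hilbert space of $C^1$ vector fields on $M$ which vanish on $\partial M$ (extended by $0$ outside $M$), and $S$ a Hilbert space of $C^1$ vector fields on $\mathbb R$, both continuously injected in $C^1$: there is a constant $c$ with $\|v\|_\infty+\|dv\|_\infty\le c\|v\|_V$ and $\|s\|_\infty+\|s'\|_\infty\le c\|s\|_S$ for all $v\in V$, $s\in S$. Let $k_V,k_S$ be their reproducing kernels: $k_V(\cdot,x)\alpha\in V$ is the element with $\langle k_V(\cdot,x)\alpha,v\rangle_V=\langle \alpha,v(x)\rangle$ for all $v\in V$, and similarly for $S$. Assume that $k_V$ is differentiable on $M\times M$ and $k_S$ on $\mathbb R\times\mathbb R$, with Lipschitz first derivatives. Let $I_0\in \mathrm{Im}(M)$, i.e. $I_0\in BV(M)$ and $M$ has a finite partition into Lipschitz domains on each of which $I_0$ is Lipschitz. (A Lipschitz domain is a set $U$ with $\Omega\subset U\subset\overline\Omega$ for a Lipschitz open set $\Omega$.) Let $J_{I_0}\subset M$ be the jump set of $I_0$, equipped with the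 $(n-1)$-dimensional Hausdorff measure $\mu_{|J_{I_0}}$, and let $$(p_a,p_b,p_c)\in L^1(M,\mathbb R^n)\times L^1(J_{I_0},\mathbb R^n)\times L^1(M,\mathbb R).$$ For $T>0$ and a reference time $\tau\in[0,T]$, consider the system on $[0,T]$ with unknown $(v,s)\in L^2([0,T],V)\times L^2([0,T],S)$, $$\eta_{r,t}=\mathrm{Id}+\int_r^t s_u\circ\eta_{r,u}\,du,\qquad \phi_{r,t}=\mathrm{Id}+\int_r^t v_u\circ\phi_{r,u}\,du\qquad(r,t\in[0,T]),$$ $$\beta s_t=\int_M p_c(y)\,d[\eta_{t,0}]_{I_t(y)}\,k_S(\cdot,I_t(y))\,d\mu(y),\qquad I_t=\eta_{0,t}\circ I_0\circ\phi_{\tau,0},$$ $$\lambda v_t=\int_M k_V(\cdot,\phi_{0,t}(x))\,[d\phi_{0,t}]_x^{-1*}p_a(x)\,d\mu(x)+\int_{J_{I_0}}k_V(\cdot,\phi_{0,t}(x))\,[d\phi_{0,t}]_x^{-1*}p_b(x)\,d\mu_{|J_{I_0}}(x),$$ where $\phi_{r,t}:M\to M$ and $\eta_{r,t}:\mathbb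 R\to\mathbb R$ are the flows, continuous in $t$, of $v$ and $s$ from time $r$ to time $t$, and the last two equations hold for almost every $t\in[0,T]$. (For $\tau=0$ this is $I_t=\eta_{0,t}\circ I_0$; for $\tau=T$ it is $I_t=\eta_{0,t}\circ I_0\circ\phi_{T,0}$.) Then there is $T_0>0$ such that for every $T\in(0,T_0]$ and every $\tau\in[0,T]$ this system has a unique solution: a solution exists, and any two solutions have the same $v$ and $s$ as elements of $L^2([0,T],V)$ and $L^2([0,T],S)$ and the same flows $\phi_{r,t}$ on $M$ and $\eta_{r,t}$ on $\mathbb R$, $r,t\in[0,T]$. -/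

import Mathlib

open Set Filter Topology MeasureTheory
open scoped NNReal ENNReal

namespace ImageMatching

noncomputable section

/-- `ℝⁿ` with its Euclidean structure. -/
abbrev Rn (n : ℕ) : Type := EuclideanSpace ℝ (Fin n)

/-! ### Discontinuous images -/

/-- Lipschitz open sets: near each boundary point, after an affine isometry, the set is the open
region above the graph of a Lipschitz function of `n - 1` variables; the Lipschitz constant does
not depend on the boundary point. -/
def IsLipschitzOpen {n : ℕ} (U : Set (Rn n)) : Prop :=
  IsOpen U ∧ U.Nonempty ∧ ∃ K : ℝ≥0, ∀ x ∈ frontier U,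
    ∃ (e : Rn n ≃ᵃⁱ[ℝ] WithLp 2 (Rn (n - 1) × ℝ)) (N : Set (Rn n)) (w : Rn (n - 1) → ℝ),
      IsOpen N ∧ x ∈ N ∧ LipschitzWith K w ∧ ∀ z ∈ N, z ∈ U ↔ w (e z).fst < (e z).snd

/-- Lipschitz domains: sets lying between a Lipschitz open set and its closure. -/
def IsLipschitzDomain {n : ℕ} (U : Set (Rn n)) : Prop :=
  ∃ Ω : Set (Rn n), IsLipschitzOpen Ω ∧ Ω ⊆ U ∧ U ⊆ closure Ω

/-- The divergence of a vector field on `ℝⁿ`. -/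
def divergence {n : ℕ} (ψ : Rn n → Rn n) (x : Rn n) : ℝ :=
  ∑ i, (fderiv ℝ ψ x (EuclideanSpace.single i 1)) i

/-- `f ∈ BV(M)`: `f ∈ L¹(M)` and its variation in `M` is finite. -/
def IsBV {n : ℕ} (M : Set (Rn n)) (f : Rn n → ℝ) : Prop :=
  IntegrableOn f M ∧
    BddAbove {r : ℝ | ∃ ψ : Rn n → Rn n, ContDiff ℝ 1 ψ ∧ HasCompactSupport ψ ∧
      tsupport ψ ⊆ M ∧ (∀ x, ‖ψ x‖ ≤ 1) ∧ r = ∫ x in M, f x * divergence ψ x}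

/-- `f ∈ Im(M)`: `f ∈ BV(M)`, and `M` has a finite partition into Lipschitz domains on each of
which `f` is Lipschitz. Only the values of `f` on `M` matter. -/
def IsImage {n : ℕ} (M : Set (Rn n)) (f : Rn n → ℝ) : Prop :=
  IsBV M f ∧ ∃ (k : ℕ) (U : Fin (k + 1) → Set (Rn n)),
    (∀ i, IsLipschitzDomain (U i)) ∧ Pairwise (fun i j => Disjoint (U i) (U j)) ∧
    (⋃ i, U i) = M ∧ ∀ i, ∃ K : ℝ≥0, LipschitzOnWith K f (U i)

/-- The half ball of centre `x` and radius `r` in the direction `ν`. -/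
def halfBall {n : ℕ} (x ν : Rn n) (r : ℝ) : Set (Rn n) :=
  {y | y ∈ Metric.ball x r ∧ 0 < inner ℝ (y - x) ν}

/-- The jump set `J_f` of `f` in `M`: the points `x ∈ M` at which, for some unit vector `ν`, the
function has distinct one-sided approximate limits `a` (on the side of `ν`) and `b` (on the side
of `-ν`). -/
def jumpSet {n : ℕ} (M : Set (Rn n)) (f : Rn n → ℝ) : Set (Rn n) :=
  {x | x ∈ M ∧ ∃ (a b : ℝ) (ν : Rn n), a ≠ b ∧ ‖ν‖ = 1 ∧
    Tendsto (fun r : ℝ => ⨍ y in halfBall x ν r, |f y - a|) (𝓝[>] 0) (𝓝 0) ∧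
    Tendsto (fun r : ℝ => ⨍ y in halfBall x (-ν) r, |f y - b|) (𝓝[>] 0) (𝓝 0)}

/-! ### Hilbert spaces of vector fields and their kernels -/

section Fields

variable {E : Type*} [NormedAddCommGroup E] [InnerProductSpace ℝ E]

/-- `H` is a space of `C¹` vector fields on the open set `D`, vanishing on `∂D` and continuously
injected in `C¹`. A field on `D` that vanishes on `∂D` is represented by its extension by `0` to
the whole space. (Injectivity of `v ↦ (x ↦ v x)` is part of the class `RKHS`.) -/
structure IsC1FieldSpace (D : Set E) (H : Type*) [NormedAddCommGroup H] [InnerProductSpace ℝ H]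
    [RKHS ℝ H E E] : Prop where
  zero_off : ∀ v : H, ∀ x, x ∉ D → v x = 0
  cont : ∀ v : H, Continuous (fun x => v x)
  contDiffOn : ∀ v : H, ContDiffOn ℝ 1 (fun x => v x) D
  bound : ∃ c : ℝ, ∀ v : H, ∀ x ∈ D,
    ‖v x‖ ≤ c * ‖v‖ ∧ ‖fderiv ℝ (fun y => v y) x‖ ≤ c * ‖v‖

/-- The reproducing kernel of `H`, as a function on `D × D`, is differentiable and its first
derivative is Lipschitz. -/
def HasLipschitzDerivKernel [CompleteSpace E] (D : Set E) (H : Type*) [NormedAddCommGroup H]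
    [InnerProductSpace ℝ H] [CompleteSpace H] [RKHS ℝ H E E] : Prop :=
  DifferentiableOn ℝ (fun q : E × E => RKHS.kernel H q.1 q.2) (D ×ˢ D) ∧
  ∃ L : ℝ≥0, LipschitzOnWith L (fderiv ℝ (fun q : E × E => RKHS.kernel H q.1 q.2)) (D ×ˢ D)

/-- `φ s t`, for `s, t ∈ [0, T]`, is the flow on `D` from time `s` to time `t` of the time
dependent vector field `v`: `φ s t x = x + ∫ₛᵗ v_u (φ s u x) du`. -/
def IsFlow (T : ℝ) (D : Set E) (v : ℝ → E → E) (φ : ℝ → ℝ → E → E) : Prop :=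
  ∀ s ∈ Icc 0 T, ∀ x ∈ D, ContinuousOn (fun t => φ s t x) (Icc 0 T) ∧
    ∀ t ∈ Icc 0 T, φ s t x ∈ D ∧ φ s t x = x + ∫ u in s..t, v u (φ s u x)

end Fields

/-- `L²([0,T], H)`. -/
abbrev L2path (T : ℝ) (H : Type*) [NormedAddCommGroup H] :=
  Lp H 2 ((volume : Measure ℝ).restrict (Icc 0 T))

/-- The transported momentum `[dφ]ₓ^{-1*} p`. -/
def pushMomentum {n : ℕ} (φ : Rn n → Rn n) (x p : Rn n) : Rn n :=
  ContinuousLinearMap.adjoint (fderiv ℝ φ x).inverse p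

/-- `(v, s)` with flows `φ`, `η` is a solution on `[0, T]` of the system

* `η_{0,t} = Id + ∫₀ᵗ s_u ∘ η_{0,u} du`,
* `β s_t = ∫_M p_c(y) d[η_{t,0}]_{I_t(y)} k_S(I_t(y), ·) dμ(y)`,
* `φ_{0,t} = Id + ∫₀ᵗ v_u ∘ φ_{0,u} du`,
* `λ v_t = ∫_M k_V(·, φ_{0,t}(x)) [dφ_{0,t}]ₓ^{-1*} p_a(x) dμ(x)`
  `+ ∫_{J_{I₀}} k_V(·, φ_{0,t}(x)) [dφ_{0,t}]ₓ^{-1*} p_b(x) dμ_{|J_{I₀}}(x)`,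

where `I_t = η_{0,t} ∘ I₀ ∘ φ_{τ,0}` and `μ_{|J}` is the `(n-1)`-dimensional Hausdorff measure
on `J`. The equations for `s_t` and `v_t` hold for almost every `t`. -/
structure IsSolution {n : ℕ} (M : Set (Rn n)) {V S : Type*}
    [NormedAddCommGroup V] [InnerProductSpace ℝ V] [CompleteSpace V] [RKHS ℝ V (Rn n) (Rn n)]
    [NormedAddCommGroup S] [InnerProductSpace ℝ S] [CompleteSpace S] [RKHS ℝ S ℝ ℝ]
    (lam β : ℝ) (I₀ : Rn n → ℝ) (pa pb : Rn n → Rn n) (pc : Rn n → ℝ) (T τ : ℝ)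
    (v : L2path T V) (s : L2path T S)
    (φ : ℝ → ℝ → Rn n → Rn n) (η : ℝ → ℝ → ℝ → ℝ) : Prop where
  flow_s : IsFlow T univ (fun t z => s t z) η
  eq_s : ∀ᵐ t ∂((volume : Measure ℝ).restrict (Icc 0 T)), ∀ z : ℝ,
    β * s t z = ∫ y in M, RKHS.kernel S z (η 0 t (I₀ (φ τ 0 y)))
      (pc y * deriv (η t 0) (η 0 t (I₀ (φ τ 0 y))))
  flow_v : IsFlow T M (fun t x => v t x) φ
  eq_v : ∀ᵐ t ∂((volume : Measure ℝ).restrict (Icc 0 T)), ∀ z : Rn n,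
    lam • v t z =
      (∫ x in M, RKHS.kernel V z (φ 0 t x) (pushMomentum (φ 0 t) x (pa x))) +
      ∫ x in jumpSet M I₀, RKHS.kernel V z (φ 0 t x) (pushMomentum (φ 0 t) x (pb x))
        ∂(Measure.euclideanHausdorffMeasure (n - 1) : Measure (Rn n))

end

end ImageMatching

open ImageMatching

/-!
The equation for `v` involves neither `s` nor `τ`, so it is solved first. The equation for `s` then
has the same form: with the labels `ζ = I₀ ∘ φ_{τ,0}` in place of the points of `M`, both say that
a field `h` is generated by a momentum `p` which is transported along the flow `φ` of `h`,
`h_t = ∫ k(·, φ_{0,t}(ζ y)) [dφ_{t,0}]^* p(y) dν(y)` (`momentumField`, `IsEvolution`). For `v` the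
particles are the points of `M` together with those of the jump set, and `[dφ_{t,0}]` taken at
`φ_{0,t}(x)` is the inverse of `[dφ_{0,t}]ₓ`.

All estimates concern fields with `c * ∫ ‖h u‖ du ≤ 1 / 2`, where `c * ‖v‖` bounds the Lipschitz
constant of `v` (`IsShort`). For these Grönwall's lemma is the remark that `m ≤ a + m / 2` implies
`m ≤ 2 * a`, and the integral equations with merely measurable time dependence are solved by one
contraction (`exists_integral_curve`). The flow of such a field preserves the open set, is
`2`-Lipschitz, and is differentiable with derivative solving the linearised equation
(`IsFlow.hasFDerivAt`).

* A priori bound (`IsEvolution.isShort`): as long as `h` is short, derivatives of its flow are at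
  most `2`, hence `‖h t‖ ≤ 2 * c * ‖p‖₁`. On a short time interval this bound keeps `h` short.
* Contraction (`norm_momentumField_sub_le_of_field`): two fields at distance `Δ` generate, through
  their flows and the derivatives of these, fields at distance at most `C * T * Δ`. Comparing the
  derivatives needs a Lipschitz bound on the derivative of one of the fields. An element of the
  Hilbert space need not satisfy one, but a field generated by a momentum does, since the
  derivative of the kernel is Lipschitz.

Uniqueness follows by iterating the contraction estimate (`IsEvolution.ae_eq`), and existence from
the contraction principle in the continuous paths with these bounds (`exists_isEvolution`).
-/

namespace ImageMatching

/-! ### Integral equations on a short time interval -/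

section IntegralEquations

theorem intervalIntegrable_of_mem_Icc {X : Type*} [NormedAddCommGroup X] {T : ℝ} {F : ℝ → X}
    (hF : IntegrableOn F (Icc 0 T))
    {s t : ℝ} (hs : s ∈ Icc 0 T) (ht : t ∈ Icc 0 T) : IntervalIntegrable F volume s t :=
  (hF.mono_set (uIcc_subset_Icc hs ht)).intervalIntegrable

variable {X : Type*} [NormedAddCommGroup X] [NormedSpace ℝ X] {T : ℝ}

theorem norm_intervalIntegral_le_setIntegral {F : ℝ → X} {G : ℝ → ℝ}
    (hG : IntegrableOn G (Icc 0 T))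
    (hFG : ∀ᵐ u ∂((volume : Measure ℝ).restrict (Icc 0 T)), ‖F u‖ ≤ G u)
    {s t : ℝ} (hs : s ∈ Icc 0 T) (ht : t ∈ Icc 0 T) :
    ‖∫ u in s..t, F u‖ ≤ ∫ u in Icc 0 T, G u := by
  have hsub : Set.uIoc s t ⊆ Icc 0 T := uIoc_subset_uIcc.trans (uIcc_subset_Icc hs ht)
  rw [intervalIntegral.norm_integral_eq_norm_integral_uIoc]
  calc ‖∫ u in Set.uIoc s t, F u‖ ≤ ∫ u in Set.uIoc s t, G u :=
        norm_integral_le_of_norm_le (hG.mono_set hsub)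
          (ae_restrict_of_ae_restrict_of_subset hsub hFG)
    _ ≤ ∫ u in Icc 0 T, G u := by
        refine setIntegral_mono_set hG ?_ hsub.eventuallyLE
        filter_upwards [hFG] with u hu using (norm_nonneg _).trans hu

/-- Grönwall's lemma in the regime where the coefficient has integral at most `1 / 2`: a bounded
quantity that improves every bound `m` to `a + m / 2` is bounded by `2 * a`. -/
theorem le_two_mul_of_half_bound {ι : Type*} {f : ι → ℝ} {S : Set ι} {a : ℝ}
    (hbdd : ∃ m, ∀ i ∈ S, f i ≤ m)
    (hstep : ∀ m, (∀ i ∈ S, f i ≤ m) → ∀ i ∈ S, f i ≤ a + m / 2) {i : ι} (hi : i ∈ S) :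
    f i ≤ 2 * a := by
  obtain ⟨m, hm⟩ := hbdd
  have hb : BddAbove (f '' S) := ⟨m, by rintro _ ⟨j, hj, rfl⟩; exact hm j hj⟩
  have h1 : ∀ j ∈ S, f j ≤ sSup (f '' S) := fun j hj => le_csSup hb (mem_image_of_mem f hj)
  have h2 : sSup (f '' S) ≤ a + sSup (f '' S) / 2 := by
    refine csSup_le ⟨_, mem_image_of_mem f hi⟩ ?_
    rintro _ ⟨j, hj, rfl⟩
    exact hstep _ h1 j hj
  have := h1 i hi
  linarith

/-- The integral form of Picard's theorem for a right hand side that is merely measurable in time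
and whose Lipschitz constant has integral at most `1 / 2`, so that the Picard map is a
contraction on the whole interval. -/
theorem exists_integral_curve [CompleteSpace X] {f : ℝ → X → X} {g : ℝ → ℝ} {b : ℝ → ℝ}
    (hgpos : ∀ u, 0 ≤ g u) (hg : IntegrableOn g (Icc 0 T)) (hg2 : ∫ u in Icc 0 T, g u ≤ 1 / 2)
    (hb : IntegrableOn b (Icc 0 T))
    (hmeas : ∀ γ : ℝ → X, Continuous γ → AEStronglyMeasurable (fun u => f u (γ u))
      ((volume : Measure ℝ).restrict (Icc 0 T)))
    (hlip : ∀ u x y, ‖f u x - f u y‖ ≤ g u * ‖x - y‖)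
    (hbound : ∀ u, ‖f u 0‖ ≤ b u) (x₀ : X) {s : ℝ} (hs : s ∈ Icc 0 T) :
    ∃ γ : ℝ → X, Continuous γ ∧ ∀ t ∈ Icc 0 T, γ t = x₀ + ∫ u in s..t, f u (γ u) := by
  have hT : (0 : ℝ) ≤ T := hs.1.trans hs.2
  have hg0 : ∀ u (γ : ℝ → X), ‖f u (γ u)‖ ≤ b u + g u * ‖γ u‖ := fun u γ => by
    have h1 := hlip u (γ u) 0
    have h2 := norm_add_le (f u (γ u) - f u 0) (f u 0)
    rw [sub_add_cancel] at h2
    rw [sub_zero] at h1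
    linarith [hbound u]
  have hint : ∀ γ : C(Icc (0 : ℝ) T, X),
      IntegrableOn (fun u => f u (IccExtend hT γ u)) (Icc 0 T) := fun γ => by
    have hc : Continuous (IccExtend hT γ) := γ.continuous.Icc_extend'
    obtain ⟨m, hm⟩ := isCompact_Icc.exists_bound_of_continuousOn hc.continuousOn
    refine Integrable.mono' (g := fun u => b u + g u * ‖IccExtend hT γ u‖)
      (hb.add ?_) (hmeas _ hc) (Eventually.of_forall fun u => hg0 u _)
    refine Integrable.mul_bdd hg hc.norm.aestronglyMeasurable (c := m) ?_
    filter_upwards [ae_restrict_mem measurableSet_Icc] with u hu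
    simpa using hm u hu
  have hcont : ∀ γ : C(Icc (0 : ℝ) T, X),
      Continuous (fun t : Icc (0 : ℝ) T => x₀ + ∫ u in s..(t : ℝ), f u (IccExtend hT γ u)) :=
    fun γ => by
    have := intervalIntegral.continuousOn_primitive_interval' (a := s)
      (intervalIntegrable_of_mem_Icc (hint γ) (left_mem_Icc.2 hT) (right_mem_Icc.2 hT))
      (by rwa [uIcc_of_le hT])
    rw [uIcc_of_le hT] at this
    exact continuous_const.add (continuousOn_iff_continuous_domRestrict.1 this)
  let Ψ : C(Icc (0 : ℝ) T, X) → C(Icc (0 : ℝ) T, X) := fun γ => ⟨_, hcont γ⟩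
  have hΨ : ContractingWith (1 / 2 : ℝ≥0) Ψ := by
    refine ⟨by norm_num, LipschitzWith.of_dist_le_mul fun γ γ' => ?_⟩
    rw [ContinuousMap.dist_le (by positivity)]
    intro t
    have : dist (Ψ γ t) (Ψ γ' t) = ‖∫ u in s..(t : ℝ),
        (f u (IccExtend hT γ u) - f u (IccExtend hT γ' u))‖ := by
      rw [intervalIntegral.integral_sub
        (intervalIntegrable_of_mem_Icc (hint γ) hs t.2)
        (intervalIntegrable_of_mem_Icc (hint γ') hs t.2), dist_eq_norm]
      simp [Ψ]
    rw [this]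
    refine (norm_intervalIntegral_le_setIntegral (G := fun u => g u * dist γ γ')
      (Integrable.mul_const hg _) (Eventually.of_forall fun u => ?_) hs t.2).trans ?_
    · refine (hlip u _ _).trans ?_
      refine mul_le_mul_of_nonneg_left ?_ (hgpos u)
      rw [← dist_eq_norm]; exact ContinuousMap.dist_apply_le_dist _
    · rw [integral_mul_const]
      have : ((1 / 2 : ℝ≥0) : ℝ) = 1 / 2 := by norm_num
      rw [this]
      exact mul_le_mul_of_nonneg_right hg2 dist_nonneg
  have : Nonempty C(Icc (0 : ℝ) T, X) := ⟨ContinuousMap.const _ x₀⟩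
  set γ := hΨ.fixedPoint with hγ
  refine ⟨IccExtend hT γ, γ.continuous.Icc_extend', fun t ht => ?_⟩
  have h1 : Ψ γ ⟨t, ht⟩ = γ ⟨t, ht⟩ := DFunLike.congr_fun hΨ.fixedPoint_isFixedPt _
  rw [IccExtend_of_mem _ _ ht, ← h1]
  rfl

end IntegralEquations

/-! ### Uniform bounds in a Hilbert space of `C¹` fields -/

section FieldBounds

/-- A continuous function that vanishes off an open set, and whose derivative on this set is
bounded by `C`, is Lipschitz: two points closer to each other than to the complement lie in a ball
inside the set, and otherwise each value is at most `C` times the distance to the complement. -/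
theorem norm_sub_le_of_zero_off {E : Type*} [NormedAddCommGroup E] [InnerProductSpace ℝ E]
    [FiniteDimensional ℝ E] {D : Set E} (hD : IsOpen D) {f : E → E}
    {C : ℝ} (hC : 0 ≤ C) (hf : Continuous f) (hzero : ∀ x, x ∉ D → f x = 0)
    (hdiff : ∀ x ∈ D, DifferentiableAt ℝ f x) (hbd : ∀ x ∈ D, ‖fderiv ℝ f x‖ ≤ C) (x y : E) :
    ‖f x - f y‖ ≤ 2 * C * ‖x - y‖ := by
  have : ProperSpace E := FiniteDimensional.proper_real E
  have hconv : ∀ B : Set E, Convex ℝ B → B ⊆ D → ∀ a ∈ B, ∀ b ∈ B, ‖f a - f b‖ ≤ C * ‖a - b‖ :=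
    fun B hB hBD a ha b hb =>
      hB.norm_image_sub_le_of_norm_fderiv_le (𝕜 := ℝ) (fun z hz => hdiff z (hBD hz))
        (fun z hz => hbd z (hBD hz)) hb ha
  rcases (Dᶜ : Set E).eq_empty_or_nonempty with he | hne
  · have := hconv univ convex_univ (by rw [compl_empty_iff.1 he]) x (mem_univ _) y (mem_univ _)
    have h0 : 0 ≤ C * ‖x - y‖ := by positivity
    linarith
  have hball : ∀ z, Metric.ball z (Metric.infDist z Dᶜ) ⊆ D := fun z w hw => by
    by_contra h
    exact absurd (Metric.infDist_le_dist_of_mem (x := z) (show w ∈ Dᶜ from h))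
      (not_le.2 (by rwa [dist_comm]))
  have hpt : ∀ z, ‖f z‖ ≤ C * Metric.infDist z Dᶜ := fun z => by
    by_cases hz : z ∈ D
    · obtain ⟨w, hwD, hw⟩ := hD.isClosed_compl.exists_infDist_eq_dist hne z
      have hr : Metric.infDist z Dᶜ ≠ 0 := by
        rw [hw]; exact dist_ne_zero.2 fun h => hwD (h ▸ hz)
      have hmem : w ∈ closure (Metric.ball z (Metric.infDist z Dᶜ)) := by
        rw [closure_ball _ hr, Metric.mem_closedBall, dist_comm, hw]
      have hclosed : IsClosed {w | ‖f z - f w‖ ≤ C * Metric.infDist z Dᶜ} :=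
        isClosed_le (continuous_const.sub hf).norm continuous_const
      have : ‖f z - f w‖ ≤ C * Metric.infDist z Dᶜ := by
        refine closure_minimal (fun b hb => ?_) hclosed hmem
        have hzb : z ∈ Metric.ball z (Metric.infDist z Dᶜ) :=
          Metric.mem_ball_self (lt_of_le_of_ne Metric.infDist_nonneg hr.symm)
        refine (hconv _ (convex_ball _ _) (hball z) z hzb b hb).trans ?_
        refine mul_le_mul_of_nonneg_left ?_ hC
        rw [← dist_eq_norm, dist_comm]; exact (Metric.mem_ball.1 hb).le
      rwa [hzero w hwD, sub_zero] at this
    · rw [hzero z hz, norm_zero]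
      exact mul_nonneg hC Metric.infDist_nonneg
  by_cases hxy : ‖x - y‖ < Metric.infDist x Dᶜ
  · have h1 := hconv _ (convex_ball _ _) (hball x) x
      (Metric.mem_ball_self ((norm_nonneg _).trans_lt hxy)) y
      (by rwa [Metric.mem_ball, dist_comm, dist_eq_norm])
    have h0 : 0 ≤ C * ‖x - y‖ := by positivity
    linarith
  by_cases hyx : ‖x - y‖ < Metric.infDist y Dᶜ
  · have h1 := hconv _ (convex_ball _ _) (hball y) x
      (by rwa [Metric.mem_ball, dist_eq_norm]) y
      (Metric.mem_ball_self ((norm_nonneg _).trans_lt hyx))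
    have h0 : 0 ≤ C * ‖x - y‖ := by positivity
    linarith
  · have h1 := (hpt x).trans (mul_le_mul_of_nonneg_left (not_lt.1 hxy) hC)
    have h2 := (hpt y).trans (mul_le_mul_of_nonneg_left (not_lt.1 hyx) hC)
    linarith [norm_sub_le (f x) (f y)]

variable {E : Type*} [NormedAddCommGroup E] [InnerProductSpace ℝ E] [CompleteSpace E]
variable {H : Type*} [NormedAddCommGroup H] [InnerProductSpace ℝ H] [CompleteSpace H]
  [RKHS ℝ H E E]

/-- The uniform bounds on which all estimates rest: the elements `v` of `H` vanish off the open
set `D`, are bounded and globally Lipschitz with constant `c * ‖v‖`, are `C¹` on `D`, and the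
fields `k(·, y) α` have a derivative which is Lipschitz on `D` with constant `L * ‖α‖`. -/
structure FieldBounds (D : Set E) (H : Type*) [NormedAddCommGroup H] [InnerProductSpace ℝ H]
    [CompleteSpace H] [RKHS ℝ H E E] (c L : ℝ) : Prop where
  isOpen : IsOpen D
  c_pos : 0 < c
  L_nonneg : 0 ≤ L
  zero_off : ∀ v : H, ∀ x, x ∉ D → v x = 0
  norm_le : ∀ (v : H) x, ‖v x‖ ≤ c * ‖v‖
  lip : ∀ (v : H) x y, ‖v x - v y‖ ≤ c * ‖v‖ * ‖x - y‖
  diff : ∀ v : H, ∀ x ∈ D, DifferentiableAt ℝ (fun y => v y) x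
  fderiv_le : ∀ v : H, ∀ x ∈ D, ‖fderiv ℝ (fun y => v y) x‖ ≤ c * ‖v‖
  fderiv_cont : ∀ v : H, ContinuousOn (fderiv ℝ (fun y => v y)) D
  ker_lip : ∀ (y α : E), ∀ z ∈ D, ∀ z' ∈ D,
    ‖fderiv ℝ (fun x => RKHS.kerFun H y α x) z - fderiv ℝ (fun x => RKHS.kerFun H y α x) z'‖
      ≤ L * ‖α‖ * ‖z - z'‖

theorem exists_fieldBounds [FiniteDimensional ℝ E] {D : Set E} (hD : IsOpen D)
    (hH : IsC1FieldSpace D H) (hk : HasLipschitzDerivKernel D H) :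
    ∃ c L : ℝ, FieldBounds D H c L := by
  obtain ⟨c₀, hc₀⟩ := hH.bound
  obtain ⟨hkd, L, hL⟩ := hk
  set C := max c₀ 1 with hCdef
  have hC1 : 1 ≤ C := le_max_right _ _
  have hle : ∀ v : H, c₀ * ‖v‖ ≤ C * ‖v‖ := fun v =>
    mul_le_mul_of_nonneg_right (le_max_left _ _) (norm_nonneg _)
  have hdiff : ∀ v : H, ∀ x ∈ D, DifferentiableAt ℝ (fun y => v y) x := fun v x hx =>
    ((hH.contDiffOn v).contDiffAt (hD.mem_nhds hx)).differentiableAt (by norm_num)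
  -- the factor `2` is the loss in the Lipschitz constant on the whole space
  refine ⟨2 * C, L, hD, by linarith, L.2, hH.zero_off, fun v x => ?_, fun v x y => ?_, hdiff,
    fun v x hx => ?_, fun v => (hH.contDiffOn v).continuousOn_fderiv_of_isOpen hD (by norm_num),
    fun y α z hz z' hz' => ?_⟩
  · have h0 : 0 ≤ C * ‖v‖ := by positivity
    by_cases hx : x ∈ D
    · linarith [(hc₀ v x hx).1, hle v]
    · rw [hH.zero_off v x hx, norm_zero]; linarith
  · have := norm_sub_le_of_zero_off hD (C := C * ‖v‖) (by positivity) (hH.cont v) (hH.zero_off v)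
      (hdiff v) (fun x hx => (hc₀ v x hx).2.trans (hle v)) x y
    calc _ ≤ _ := this
      _ = _ := by ring
  · have h0 : 0 ≤ C * ‖v‖ := by positivity
    linarith [(hc₀ v x hx).2, hle v]
  · by_cases hy : y ∈ D
    · have hder : ∀ w ∈ D, ∀ ξ : E, fderiv ℝ (fun x => RKHS.kerFun H y α x) w ξ =
          fderiv ℝ (fun q : E × E => RKHS.kernel H q.1 q.2) (w, y) (ξ, 0) α := by
        intro w hw ξ
        have h1 : HasFDerivAt (fun q : E × E => RKHS.kernel H q.1 q.2)
            (fderiv ℝ (fun q : E × E => RKHS.kernel H q.1 q.2) (w, y)) (w, y) :=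
          (hkd.differentiableAt ((hD.prod hD).mem_nhds ⟨hw, hy⟩)).hasFDerivAt
        have h2 : HasFDerivAt (fun x : E => (x, y)) (ContinuousLinearMap.inl ℝ E E) w :=
          (hasFDerivAt_prodMk_left w y)
        have h3 := ((h1.comp w h2).clm_apply (hasFDerivAt_const α w)).fderiv
        have h4 : (fun x => RKHS.kerFun H y α x) =
            fun x => ((fun q : E × E => RKHS.kernel H q.1 q.2) ∘ fun x => (x, y)) x α := by
          funext x; simp [RKHS.kerFun_apply]
        rw [h4, h3]
        simp
      refine ContinuousLinearMap.opNorm_le_bound _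
        (mul_nonneg (mul_nonneg L.2 (norm_nonneg _)) (norm_nonneg _)) fun ξ => ?_
      rw [sub_apply, hder z hz, hder z' hz', ← sub_apply,
        ← sub_apply]
      have h5 := hL.norm_sub_le (show ((z, y) : E × E) ∈ D ×ˢ D from ⟨hz, hy⟩)
        (show ((z', y) : E × E) ∈ D ×ˢ D from ⟨hz', hy⟩)
      have h6 : ‖((z, y) : E × E) - (z', y)‖ = ‖z - z'‖ := by
        simp [Prod.norm_def]
      rw [h6] at h5
      have h7 : ‖((ξ, 0) : E × E)‖ = ‖ξ‖ := by simp [Prod.norm_def]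
      calc _ ≤ ‖(fderiv ℝ (fun q : E × E => RKHS.kernel H q.1 q.2) (z, y) -
              fderiv ℝ (fun q : E × E => RKHS.kernel H q.1 q.2) (z', y))‖ * ‖((ξ, 0) : E × E)‖
              * ‖α‖ := ContinuousLinearMap.le_opNorm₂ _ _ _
        _ ≤ (L * ‖z - z'‖) * ‖ξ‖ * ‖α‖ := by rw [h7]; gcongr
        _ = _ := by ring
    -- for `y` off `D` the field `k(·, y) α` vanishes, as it represents evaluation at `y`
    · have h0 : RKHS.kerFun H y α = 0 := by
        refine ext_inner_right ℝ fun v => ?_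
        rw [RKHS.kerFun_inner, hH.zero_off v y hy, inner_zero_right, inner_zero_left]
      rw [h0]
      simp only [RKHS.coe_zero, Pi.zero_apply, fderiv_fun_const, sub_self, norm_zero]
      exact mul_nonneg (mul_nonneg L.2 (norm_nonneg _)) (norm_nonneg _)

namespace FieldBounds

variable {D : Set E} {c L : ℝ}

theorem norm_kerFun_le (hB : FieldBounds D H c L) (y : E) : ‖RKHS.kerFun H y‖ ≤ c := by
  rw [← LinearIsometryEquiv.norm_map ContinuousLinearMap.adjoint]
  refine ContinuousLinearMap.opNorm_le_bound _ hB.c_pos.le fun v => ?_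
  rw [RKHS.adjoint_kerFun]
  exact hB.norm_le v y

theorem norm_kerFun_sub_le (hB : FieldBounds D H c L) (y y' : E) :
    ‖RKHS.kerFun H y - RKHS.kerFun H y'‖ ≤ c * ‖y - y'‖ := by
  rw [← LinearIsometryEquiv.norm_map ContinuousLinearMap.adjoint]
  refine ContinuousLinearMap.opNorm_le_bound _
    (mul_nonneg hB.c_pos.le (norm_nonneg _)) fun v => ?_
  rw [map_sub, sub_apply, RKHS.adjoint_kerFun, RKHS.adjoint_kerFun]
  exact (hB.lip v y y').trans_eq (by ring)

end FieldBounds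

end FieldBounds

/-! ### Flows of fields that are integrable in time -/

section Flows

/-- The time dependent field `h` is integrable on `[0, T]`, with an integral so small that the
Lipschitz constants `c * ‖h u‖` have integral at most `1 / 2`. -/
structure IsShort {H : Type*} [NormedAddCommGroup H] (c T : ℝ) (h : ℝ → H) : Prop where
  integrableOn : IntegrableOn h (Icc 0 T)
  integral_le : ∫ u in Icc 0 T, c * ‖h u‖ ≤ 1 / 2

namespace IsShort

variable {H : Type*} [NormedAddCommGroup H] {c T t : ℝ} {h : ℝ → H}

theorem integrableOn_norm (hS : IsShort c T h) : IntegrableOn (fun u => c * ‖h u‖) (Icc 0 T) :=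
  Integrable.const_mul hS.integrableOn.norm c

/-- The estimate behind all comparisons of integral curves: a curve whose speed is at most
`a u + c * ‖h u‖ * m` moves by at most `∫ a + m / 2`. -/
theorem norm_integral_le {X : Type*} [NormedAddCommGroup X] [NormedSpace ℝ X]
    (hS : IsShort c T h) {F : ℝ → X} {a : ℝ → ℝ} {m : ℝ} (hm : 0 ≤ m)
    (ha : IntegrableOn a (Icc 0 T))
    (hF : ∀ᵐ u ∂((volume : Measure ℝ).restrict (Icc 0 T)), ‖F u‖ ≤ a u + c * ‖h u‖ * m)
    {s t : ℝ} (hs : s ∈ Icc 0 T) (ht : t ∈ Icc 0 T) :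
    ‖∫ u in s..t, F u‖ ≤ (∫ u in Icc 0 T, a u) + m / 2 := by
  refine (norm_intervalIntegral_le_setIntegral
    (ha.add (Integrable.mul_const hS.integrableOn_norm m)) hF hs ht).trans ?_
  simp only [Pi.add_apply]
  rw [integral_add ha (Integrable.mul_const hS.integrableOn_norm m), integral_mul_const]
  have := mul_le_mul_of_nonneg_right hS.integral_le hm
  linarith

theorem mono (hS : IsShort c T h) (hc : 0 < c) (ht : t ≤ T) : IsShort c t h := by
  have hsub : Icc 0 t ⊆ Icc 0 T := Icc_subset_Icc_right ht
  exact ⟨hS.integrableOn.mono_set hsub, (setIntegral_mono_set hS.integrableOn_norm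
    (Eventually.of_forall fun u => mul_nonneg hc.le (norm_nonneg _))
    hsub.eventuallyLE).trans hS.integral_le⟩

end IsShort

variable {E : Type*} [NormedAddCommGroup E] [InnerProductSpace ℝ E] [CompleteSpace E]
variable {H : Type*} [NormedAddCommGroup H] [InnerProductSpace ℝ H] [CompleteSpace H]
  [RKHS ℝ H E E]
variable {D : Set E} {c L T : ℝ} {h : ℝ → H}

namespace FieldBounds

theorem continuous_eval (hB : FieldBounds D H c L) : Continuous (fun q : H × E => q.1 q.2) := by
  refine continuous_iff_continuousAt.2 fun ⟨v, x⟩ => ?_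
  refine tendsto_iff_norm_sub_tendsto_zero.2 ?_
  have hlim : Tendsto (fun q : H × E => c * ‖q.1 - v‖ + c * ‖v‖ * ‖q.2 - x‖) (𝓝 (v, x)) (𝓝 0) := by
    have : Continuous (fun q : H × E => c * ‖q.1 - v‖ + c * ‖v‖ * ‖q.2 - x‖) := by fun_prop
    simpa using this.tendsto (v, x)
  refine squeeze_zero (fun _ => norm_nonneg _) (fun q => ?_) hlim
  have h1 : q.1 q.2 - v x = (q.1 - v) q.2 + (v q.2 - v x) := by
    rw [RKHS.coe_sub, Pi.sub_apply]; abel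
  rw [h1]
  exact (norm_add_le _ _).trans (add_le_add (hB.norm_le _ _) (hB.lip _ _ _))

theorem fderiv_sub (hB : FieldBounds D H c L) (v w : H) {x : E} (hx : x ∈ D) :
    fderiv ℝ (fun y => (v - w) y) x = fderiv ℝ (fun y => v y) x - fderiv ℝ (fun y => w y) x := by
  have : (fun y => (v - w) y) = (fun y => v y) - fun y => w y := by
    funext y; simp
  rw [this, _root_.fderiv_sub (hB.diff v x hx) (hB.diff w x hx)]

theorem continuous_fderiv (hB : FieldBounds D H c L) :
    Continuous (fun q : H × D => fderiv ℝ (fun y => q.1 y) (q.2 : E)) := by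
  refine continuous_iff_continuousAt.2 fun ⟨v, x⟩ => ?_
  refine tendsto_iff_norm_sub_tendsto_zero.2 ?_
  have hlim : Tendsto (fun q : H × D => c * ‖q.1 - v‖ +
      ‖fderiv ℝ (fun y => v y) (q.2 : E) - fderiv ℝ (fun y => v y) (x : E)‖)
      (𝓝 (v, x)) (𝓝 0) := by
    have h1 : Continuous (fun z : D => fderiv ℝ (fun y => v y) (z : E)) :=
      continuousOn_iff_continuous_domRestrict.1 (hB.fderiv_cont v)
    have : Continuous (fun q : H × D => c * ‖q.1 - v‖ +
      ‖fderiv ℝ (fun y => v y) (q.2 : E) - fderiv ℝ (fun y => v y) (x : E)‖) := by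
      have h2 := h1.comp (continuous_snd : Continuous (Prod.snd : H × D → D))
      exact (by fun_prop : Continuous (fun q : H × D => c * ‖q.1 - v‖)).add
        (h2.sub continuous_const).norm
    simpa using this.tendsto (v, x)
  refine squeeze_zero (fun _ => norm_nonneg _) (fun q => ?_) hlim
  have h1 := hB.fderiv_sub q.1 v q.2.2
  have h2 := hB.fderiv_le (q.1 - v) q.2 q.2.2
  rw [h1] at h2
  refine (norm_sub_le_norm_sub_add_norm_sub _ (fderiv ℝ (fun y => v y) (q.2 : E)) _).trans ?_
  exact add_le_add h2 le_rfl

theorem aestronglyMeasurable_comp (hB : FieldBounds D H c L)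
    (hh : IntegrableOn h (Icc 0 T)) {γ : ℝ → E} (hγ : ContinuousOn γ (Icc 0 T)) :
    AEStronglyMeasurable (fun u => h u (γ u)) ((volume : Measure ℝ).restrict (Icc 0 T)) :=
  hB.continuous_eval.comp_aestronglyMeasurable
    (hh.aestronglyMeasurable.prodMk (hγ.aestronglyMeasurable measurableSet_Icc))

theorem aestronglyMeasurable_fderiv_comp (hB : FieldBounds D H c L)
    (hh : IntegrableOn h (Icc 0 T)) (hT : 0 ≤ T) {γ : ℝ → E} (hγ : ContinuousOn γ (Icc 0 T))
    (hγD : ∀ u ∈ Icc 0 T, γ u ∈ D) :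
    AEStronglyMeasurable (fun u => fderiv ℝ (fun y => h u y) (γ u))
      ((volume : Measure ℝ).restrict (Icc 0 T)) := by
  let γ' : ℝ → D := fun u => ⟨γ (projIcc 0 T hT u), hγD _ (projIcc 0 T hT u).2⟩
  have hγ' : Continuous γ' := by
    refine Continuous.subtype_mk ?_ _
    exact (continuousOn_iff_continuous_domRestrict.1 hγ).comp continuous_projIcc
  have := hB.continuous_fderiv.comp_aestronglyMeasurable
    (hh.aestronglyMeasurable.prodMk hγ'.aestronglyMeasurable)
  refine this.congr ?_
  filter_upwards [ae_restrict_mem measurableSet_Icc] with u hu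
  simp [γ', projIcc_of_mem hT hu]

end FieldBounds

/-- `γ` is an integral curve on `[0, T]` of the time dependent field `h`, with value `x` at the
time `s`. -/
def IsCurve (T : ℝ) (h : ℝ → H) (s : ℝ) (x : E) (γ : ℝ → E) : Prop :=
  ContinuousOn γ (Icc 0 T) ∧ ∀ t ∈ Icc 0 T, γ t = x + ∫ u in s..t, h u (γ u)

namespace IsCurve

variable {s : ℝ} {x : E} {γ : ℝ → E}

theorem integrableOn (hγ : IsCurve T h s x γ) (hB : FieldBounds D H c L) (hS : IsShort c T h) :
    IntegrableOn (fun u => h u (γ u)) (Icc 0 T) :=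
  Integrable.mono' hS.integrableOn_norm (hB.aestronglyMeasurable_comp hS.integrableOn hγ.1)
    (Eventually.of_forall fun _ => hB.norm_le _ _)

theorem rebase (hγ : IsCurve T h s x γ) (hB : FieldBounds D H c L) (hS : IsShort c T h)
    (hs : s ∈ Icc 0 T) {r : ℝ} (hr : r ∈ Icc 0 T) : IsCurve T h r (γ r) γ := by
  refine ⟨hγ.1, fun t ht => ?_⟩
  have hi := hγ.integrableOn hB hS
  rw [hγ.2 t ht, hγ.2 r hr, add_assoc, intervalIntegral.integral_add_adjacent_intervals
    (intervalIntegrable_of_mem_Icc hi hs hr)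
    (intervalIntegrable_of_mem_Icc hi hr ht)]

theorem norm_sub_le (hγ : IsCurve T h s x γ) (hB : FieldBounds D H c L) (hS : IsShort c T h)
    (hs : s ∈ Icc 0 T) {x' : E} {γ' : ℝ → E} (hγ' : IsCurve T h s x' γ') {t : ℝ}
    (ht : t ∈ Icc 0 T) : ‖γ t - γ' t‖ ≤ 2 * ‖x - x'‖ := by
  refine le_two_mul_of_half_bound (f := fun t => ‖γ t - γ' t‖) (S := Icc 0 T)
    (isCompact_Icc.exists_bound_of_continuousOn (hγ.1.sub hγ'.1).norm |>.imp
      fun m hm t ht => (le_abs_self _).trans (hm t ht)) (fun m hm t ht => ?_) ht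
  have hm0 : 0 ≤ m := (norm_nonneg _).trans (hm t ht)
  have h1 : γ t - γ' t = (x - x') + ∫ u in s..t, (h u (γ u) - h u (γ' u)) := by
    rw [intervalIntegral.integral_sub
      (intervalIntegrable_of_mem_Icc (hγ.integrableOn hB hS) hs ht)
      (intervalIntegrable_of_mem_Icc (hγ'.integrableOn hB hS) hs ht),
      hγ.2 t ht, hγ'.2 t ht]
    abel
  have h2 := hS.norm_integral_le (F := fun u => h u (γ u) - h u (γ' u)) (a := fun _ => 0) hm0
    integrableOn_zero (by
      filter_upwards [ae_restrict_mem measurableSet_Icc] with u hu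
      rw [zero_add]
      exact (hB.lip _ _ _).trans (mul_le_mul_of_nonneg_left (hm u hu)
        (mul_nonneg hB.c_pos.le (norm_nonneg _)))) hs ht
  rw [integral_zero, zero_add] at h2
  show ‖γ t - γ' t‖ ≤ _
  rw [h1]
  exact (norm_add_le _ _).trans (by linarith)

/-- An integral curve that starts in `D` stays there, because the points off `D` are at rest. -/
theorem mem (hγ : IsCurve T h s x γ) (hB : FieldBounds D H c L) (hS : IsShort c T h)
    (hs : s ∈ Icc 0 T) (hx : x ∈ D) {t : ℝ} (ht : t ∈ Icc 0 T) : γ t ∈ D := by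
  by_contra hn
  have h1 : IsCurve T h t (γ t) (fun _ => γ t) :=
    ⟨continuousOn_const, fun r _ => by simp [hB.zero_off _ _ hn]⟩
  have h2 := (hγ.rebase hB hS hs ht).norm_sub_le hB hS ht h1 hs
  rw [sub_self, norm_zero, mul_zero] at h2
  have h3 : γ s = γ t := sub_eq_zero.1 (norm_le_zero_iff.1 h2)
  have h4 : γ s = x := by rw [hγ.2 s hs]; simp
  exact hn (h3 ▸ h4 ▸ hx)

end IsCurve

theorem exists_isCurve (hB : FieldBounds D H c L) (hS : IsShort c T h) {s : ℝ}
    (hs : s ∈ Icc 0 T) (x : E) : ∃ γ, IsCurve T h s x γ := by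
  obtain ⟨γ, hγ, hγ'⟩ := exists_integral_curve (T := T) (f := fun u y => h u y)
    (fun u => mul_nonneg hB.c_pos.le (norm_nonneg (h u))) hS.integrableOn_norm hS.integral_le
    hS.integrableOn_norm
    (fun γ hγ => hB.aestronglyMeasurable_comp hS.integrableOn hγ.continuousOn)
    (fun u x y => hB.lip _ _ _) (fun u => hB.norm_le _ _) x hs
  exact ⟨γ, hγ.continuousOn, hγ'⟩

theorem exists_isFlow (hB : FieldBounds D H c L) (hS : IsShort c T h) :
    ∃ φ : ℝ → ℝ → E → E, IsFlow T D (fun t z => h t z) φ := by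
  choose! γ hγ using fun (s : ℝ) (hs : s ∈ Icc 0 T) (x : E) => exists_isCurve hB hS hs x
  refine ⟨fun s t x => γ s x t, fun s hs x hx => ⟨(hγ s hs x).1, fun t ht => ⟨?_, ?_⟩⟩⟩
  · exact (hγ s hs x).mem hB hS hs hx ht
  · exact (hγ s hs x).2 t ht

end Flows

namespace IsFlow

section

variable {E : Type*} [NormedAddCommGroup E] [InnerProductSpace ℝ E]
variable {H : Type*} [NormedAddCommGroup H] [InnerProductSpace ℝ H] [RKHS ℝ H E E]
variable {D : Set E} {T : ℝ} {h : ℝ → H} {φ : ℝ → ℝ → E → E} {s t : ℝ} {x : E}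

theorem isCurve (hφ : IsFlow T D (fun t z => h t z) φ) (hs : s ∈ Icc 0 T) (hx : x ∈ D) :
    IsCurve T h s x (fun t => φ s t x) :=
  ⟨(hφ s hs x hx).1, fun t ht => ((hφ s hs x hx).2 t ht).2⟩

theorem mem (hφ : IsFlow T D (fun t z => h t z) φ) (hs : s ∈ Icc 0 T) (ht : t ∈ Icc 0 T)
    (hx : x ∈ D) : φ s t x ∈ D :=
  ((hφ s hs x hx).2 t ht).1

theorem self (hφ : IsFlow T D (fun t z => h t z) φ) (hs : s ∈ Icc 0 T) (hx : x ∈ D) :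
    φ s s x = x := by
  have := ((hφ s hs x hx).2 s hs).2
  simpa using this

theorem mono (hφ : IsFlow T D (fun t z => h t z) φ) {T' : ℝ} (hT : T' ≤ T) :
    IsFlow T' D (fun t z => h t z) φ := fun s hs x hx =>
  have hsub : Icc 0 T' ⊆ Icc 0 T := Icc_subset_Icc_right hT
  ⟨(hφ s (hsub hs) x hx).1.mono hsub, fun t ht => (hφ s (hsub hs) x hx).2 t (hsub ht)⟩

theorem congr_ae {h' : ℝ → H} (hφ : IsFlow T D (fun t z => h t z) φ)
    (hh : ∀ᵐ t ∂((volume : Measure ℝ).restrict (Icc 0 T)), h t = h' t) :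
    IsFlow T D (fun t z => h' t z) φ := fun s hs x hx => by
  refine ⟨(hφ s hs x hx).1, fun t ht => ⟨((hφ s hs x hx).2 t ht).1, ?_⟩⟩
  rw [((hφ s hs x hx).2 t ht).2]
  congr 1
  refine intervalIntegral.integral_congr_ae' ?_ ?_
  all_goals
    have := (ae_restrict_iff' measurableSet_Icc).1 hh
    filter_upwards [this] with u hu hu'
    rw [hu]
    constructor
    · rcases hu' with ⟨h1, h2⟩; linarith [hs.1, ht.1]
    · rcases hu' with ⟨h1, h2⟩; linarith [hs.2, ht.2]

end

section

variable {E : Type*} [NormedAddCommGroup E] [InnerProductSpace ℝ E] [CompleteSpace E]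
variable {H : Type*} [NormedAddCommGroup H] [InnerProductSpace ℝ H] [CompleteSpace H]
  [RKHS ℝ H E E]
variable {D : Set E} {c L T : ℝ} {h : ℝ → H} {φ : ℝ → ℝ → E → E} {r s t : ℝ} {x y : E}

theorem norm_sub_le (hφ : IsFlow T D (fun t z => h t z) φ) (hB : FieldBounds D H c L)
    (hS : IsShort c T h) (hs : s ∈ Icc 0 T) (ht : t ∈ Icc 0 T) (hx : x ∈ D) (hy : y ∈ D) :
    ‖φ s t x - φ s t y‖ ≤ 2 * ‖x - y‖ :=
  (hφ.isCurve hs hx).norm_sub_le hB hS hs (hφ.isCurve hs hy) ht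

theorem comp (hφ : IsFlow T D (fun t z => h t z) φ) (hB : FieldBounds D H c L)
    (hS : IsShort c T h) (hr : r ∈ Icc 0 T) (hs : s ∈ Icc 0 T) (ht : t ∈ Icc 0 T) (hx : x ∈ D) :
    φ s t (φ r s x) = φ r t x := by
  have h1 := ((hφ.isCurve hr hx).rebase hB hS hr hs).norm_sub_le hB hS hs
    (hφ.isCurve hs (hφ.mem hr hs hx)) ht
  rw [sub_self, norm_zero, mul_zero] at h1
  exact (sub_eq_zero.1 (norm_le_zero_iff.1 h1)).symm

theorem eq_of_isFlow (hφ : IsFlow T D (fun t z => h t z) φ) {φ' : ℝ → ℝ → E → E}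
    (hφ' : IsFlow T D (fun t z => h t z) φ') (hB : FieldBounds D H c L)
    (hS : IsShort c T h) (hs : s ∈ Icc 0 T) (ht : t ∈ Icc 0 T) (hx : x ∈ D) :
    φ s t x = φ' s t x := by
  have h1 := (hφ.isCurve hs hx).norm_sub_le hB hS hs (hφ'.isCurve hs hx) ht
  rw [sub_self, norm_zero, mul_zero] at h1
  exact sub_eq_zero.1 (norm_le_zero_iff.1 h1)

/-- The remainder of the first order expansion of the fields along the flow is `o(‖y - x‖)` in
`L¹([0, T])`. -/
theorem tendsto_remainder (hφ : IsFlow T D (fun t z => h t z) φ) (hB : FieldBounds D H c L)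
    (hS : IsShort c T h) (hs : s ∈ Icc 0 T) (hx : x ∈ D) :
    Tendsto (fun y => ∫ u in Icc 0 T, ‖y - x‖⁻¹ * ‖h u (φ s u y) - h u (φ s u x) -
      fderiv ℝ (fun z => h u z) (φ s u x) (φ s u y - φ s u x)‖) (𝓝 x) (𝓝 0) := by
  have hT : (0 : ℝ) ≤ T := hs.1.trans hs.2
  have hD : ∀ᶠ y in 𝓝 x, y ∈ D := hB.isOpen.mem_nhds hx
  suffices hlim : Tendsto (fun y => ∫ u in Icc 0 T, ‖y - x‖⁻¹ * ‖h u (φ s u y) -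
      h u (φ s u x) - fderiv ℝ (fun z => h u z) (φ s u x) (φ s u y - φ s u x)‖) (𝓝 x)
      (𝓝 (∫ _u in Icc 0 T, (0 : ℝ))) by rwa [integral_zero] at hlim
  refine tendsto_integral_filter_of_dominated_convergence (l := 𝓝 x)
    (fun u => 4 * (c * ‖h u‖)) ?_ ?_ (hS.integrableOn_norm.const_mul 4) ?_
  · filter_upwards [hD] with y hy
    have hcx := (hφ s hs x hx).1
    have hcy := (hφ s hs y hy).1
    refine ((((hB.aestronglyMeasurable_comp hS.integrableOn hcy).sub
      (hB.aestronglyMeasurable_comp hS.integrableOn hcx)).sub ?_).norm).const_mul _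
    exact isBoundedBilinearMap_apply.continuous.comp_aestronglyMeasurable
      ((hB.aestronglyMeasurable_fderiv_comp hS.integrableOn hT hcx
        fun u hu => hφ.mem hs hu hx).prodMk
        ((hcy.sub hcx).aestronglyMeasurable measurableSet_Icc))
  · filter_upwards [hD] with y hy
    filter_upwards [ae_restrict_mem measurableSet_Icc] with u hu
    have h1 := hB.lip (h u) (φ s u y) (φ s u x)
    have h2 := hφ.norm_sub_le hB hS hs hu hy hx
    have h3 := ((fderiv ℝ (fun z => h u z) (φ s u x)).le_opNorm (φ s u y - φ s u x)).trans
      (mul_le_mul_of_nonneg_right (hB.fderiv_le (h u) _ (hφ.mem hs hu hx)) (norm_nonneg _))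
    have h4 := _root_.norm_sub_le (h u (φ s u y) - h u (φ s u x))
      (fderiv ℝ (fun z => h u z) (φ s u x) (φ s u y - φ s u x))
    have h5 : c * ‖h u‖ * ‖φ s u y - φ s u x‖ ≤ c * ‖h u‖ * (2 * ‖y - x‖) :=
      mul_le_mul_of_nonneg_left h2 (mul_nonneg hB.c_pos.le (norm_nonneg _))
    rw [norm_mul, norm_norm, norm_inv, norm_norm]
    rcases (norm_nonneg (y - x)).eq_or_lt with h6 | h6
    · rw [← h6, inv_zero, zero_mul]
      exact mul_nonneg (by norm_num) (mul_nonneg hB.c_pos.le (norm_nonneg _))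
    · rw [inv_mul_le_iff₀ h6]
      linarith
  · filter_upwards [ae_restrict_mem measurableSet_Icc] with u hu
    have hq : φ s u x ∈ D := hφ.mem hs hu hx
    have h1 := (hasFDerivAt_iff_isLittleO.1 (hB.diff (h u) _ hq).hasFDerivAt)
    have hbig : (fun y => φ s u y - φ s u x) =O[𝓝 x] fun y => y - x :=
      Asymptotics.IsBigO.of_bound 2 (by
        filter_upwards [hD] with y hy using hφ.norm_sub_le hB hS hs hu hy hx)
    have hlim : Tendsto (fun y => φ s u y) (𝓝 x) (𝓝 (φ s u x)) := by
      rw [← tendsto_sub_nhds_zero_iff]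
      refine hbig.trans_tendsto ?_
      rw [tendsto_sub_nhds_zero_iff]; exact tendsto_id
    have h2 := ((h1.comp_tendsto hlim).trans_isBigO hbig).norm_norm.tendsto_div_nhds_zero
    refine h2.congr fun y => ?_
    simp only [Function.comp_apply]
    rw [div_eq_inv_mul]

/-- The linearised equation along an integral curve. -/
theorem exists_linearized (hφ : IsFlow T D (fun t z => h t z) φ) (hB : FieldBounds D H c L)
    (hS : IsShort c T h) (hs : s ∈ Icc 0 T) (hx : x ∈ D) :
    ∃ B : ℝ → E →L[ℝ] E, Continuous B ∧ ∀ t ∈ Icc 0 T, B t = ContinuousLinearMap.id ℝ E +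
      ∫ u in s..t, (fderiv ℝ (fun z => h u z) (φ s u x)) ∘L B u := by
  have hT : (0 : ℝ) ≤ T := hs.1.trans hs.2
  have hcl : ∀ u, (projIcc 0 T hT u : ℝ) ∈ Icc 0 T := fun u => (projIcc 0 T hT u).2
  have hcx := (hφ s hs x hx).1
  -- `φ` is only constrained for times in `[0, T]`, so the time is projected to this interval
  obtain ⟨B, hBc, hBeq⟩ := exists_integral_curve (T := T) (X := E →L[ℝ] E)
    (f := fun u A => (fderiv ℝ (fun z => h u z) (φ s (projIcc 0 T hT u) x)) ∘L A)
    (g := fun u => c * ‖h u‖) (b := fun _ => 0)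
    (fun u => mul_nonneg hB.c_pos.le (norm_nonneg (h u))) hS.integrableOn_norm hS.integral_le
    integrableOn_zero
    (fun γ hγ => by
      have h1 := hB.aestronglyMeasurable_fderiv_comp hS.integrableOn hT
        (γ := fun u => φ s (projIcc 0 T hT u) x)
        (((continuousOn_iff_continuous_domRestrict.1 hcx).comp continuous_projIcc).continuousOn)
        (fun u _ => hφ.mem hs (hcl u) hx)
      exact (by fun_prop : Continuous fun q : (E →L[ℝ] E) × (E →L[ℝ] E) => q.1 ∘L q.2)
        |>.comp_aestronglyMeasurable (h1.prodMk hγ.aestronglyMeasurable))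
    (fun u A A' => by
      rw [← ContinuousLinearMap.comp_sub]
      exact (ContinuousLinearMap.opNorm_comp_le _ _).trans (mul_le_mul_of_nonneg_right
        (hB.fderiv_le _ _ (hφ.mem hs (hcl u) hx)) (norm_nonneg _)))
    (fun u => by simp) (ContinuousLinearMap.id ℝ E) hs
  refine ⟨B, hBc, fun t ht => (hBeq t ht).trans ?_⟩
  congr 1
  refine intervalIntegral.integral_congr fun u hu => ?_
  have : u ∈ Icc 0 T := uIcc_subset_Icc hs ht hu
  simp only [projIcc_of_mem hT this]

theorem integrableOn_linearized (hφ : IsFlow T D (fun t z => h t z) φ)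
    (hB : FieldBounds D H c L) (hS : IsShort c T h) (hs : s ∈ Icc 0 T) (hx : x ∈ D)
    {B : ℝ → E →L[ℝ] E} (hBc : ContinuousOn B (Icc 0 T)) :
    IntegrableOn (fun u => (fderiv ℝ (fun z => h u z) (φ s u x)) ∘L B u) (Icc 0 T) := by
  obtain ⟨m, hm⟩ := isCompact_Icc.exists_bound_of_continuousOn hBc
  have hT : (0 : ℝ) ≤ T := hs.1.trans hs.2
  refine Integrable.mono' (hS.integrableOn_norm.mul_const m) ?_ ?_
  · exact (by fun_prop : Continuous fun q : (E →L[ℝ] E) × (E →L[ℝ] E) => q.1 ∘L q.2)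
      |>.comp_aestronglyMeasurable ((hB.aestronglyMeasurable_fderiv_comp hS.integrableOn hT
        (hφ s hs x hx).1 (fun u hu => hφ.mem hs hu hx)).prodMk
        (hBc.aestronglyMeasurable measurableSet_Icc))
  · filter_upwards [ae_restrict_mem measurableSet_Icc] with u hu
    exact (ContinuousLinearMap.opNorm_comp_le _ _).trans (mul_le_mul
      (hB.fderiv_le _ _ (hφ.mem hs hu hx)) (hm u hu) (norm_nonneg _)
      (mul_nonneg hB.c_pos.le (norm_nonneg _)))

/-- The flow is differentiable in its starting point, and its derivative solves the linearised
equation. -/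
theorem hasFDerivAt (hφ : IsFlow T D (fun t z => h t z) φ) (hB : FieldBounds D H c L)
    (hS : IsShort c T h) (hs : s ∈ Icc 0 T) (hx : x ∈ D) {B : ℝ → E →L[ℝ] E}
    (hBc : Continuous B) (hBeq : ∀ t ∈ Icc 0 T, B t = ContinuousLinearMap.id ℝ E +
      ∫ u in s..t, (fderiv ℝ (fun z => h u z) (φ s u x)) ∘L B u) (ht : t ∈ Icc 0 T) :
    HasFDerivAt (φ s t) (B t) x := by
  set R : E → ℝ → E := fun y u => h u (φ s u y) - h u (φ s u x) -
      fderiv ℝ (fun z => h u z) (φ s u x) (φ s u y - φ s u x) with hR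
  have hT : (0 : ℝ) ≤ T := hs.1.trans hs.2
  have hcx := (hφ s hs x hx).1
  have hBi := hφ.integrableOn_linearized hB hS hs hx hBc.continuousOn
  -- the error of the linear approximation at `y` is at most twice the `L¹` norm of the remainder
  have key : ∀ y ∈ D, ‖φ s t y - φ s t x - B t (y - x)‖ ≤ 2 * ∫ u in Icc 0 T, ‖R y u‖ := by
    intro y hy
    have hcy := (hφ s hs y hy).1
    have hix := (hφ.isCurve hs hx).integrableOn hB hS
    have hiy := (hφ.isCurve hs hy).integrableOn hB hS
    have hdi : IntegrableOn (fun u => fderiv ℝ (fun z => h u z) (φ s u x) (φ s u y - φ s u x))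
        (Icc 0 T) := by
      obtain ⟨m, hm⟩ := isCompact_Icc.exists_bound_of_continuousOn (hcy.sub hcx)
      refine Integrable.mono' (hS.integrableOn_norm.mul_const m)
        (isBoundedBilinearMap_apply.continuous.comp_aestronglyMeasurable
          ((hB.aestronglyMeasurable_fderiv_comp hS.integrableOn hT hcx
            fun u hu => hφ.mem hs hu hx).prodMk
            ((hcy.sub hcx).aestronglyMeasurable measurableSet_Icc))) ?_
      filter_upwards [ae_restrict_mem measurableSet_Icc] with u hu
      exact (ContinuousLinearMap.le_opNorm _ _).trans (mul_le_mul
        (hB.fderiv_le _ _ (hφ.mem hs hu hx)) (hm u hu) (norm_nonneg _)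
        (mul_nonneg hB.c_pos.le (norm_nonneg _)))
    have hRi : IntegrableOn (R y) (Icc 0 T) := (hiy.sub hix).sub hdi
    have hcρ : ContinuousOn (fun u => φ s u y - φ s u x - B u (y - x)) (Icc 0 T) :=
      (hcy.sub hcx).sub (by fun_prop)
    refine le_two_mul_of_half_bound (f := fun t => ‖φ s t y - φ s t x - B t (y - x)‖)
      (S := Icc 0 T) (isCompact_Icc.exists_bound_of_continuousOn hcρ)
      (fun m hm t ht => ?_) ht
    have hm0 : 0 ≤ m := (norm_nonneg _).trans (hm t ht)
    have hBv : B t (y - x) = (y - x) +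
        ∫ u in s..t, fderiv ℝ (fun z => h u z) (φ s u x) (B u (y - x)) := by
      have h1 := ContinuousLinearMap.intervalIntegral_comp_comm
        (ContinuousLinearMap.apply ℝ E (y - x))
        (intervalIntegrable_of_mem_Icc hBi hs ht)
      simp only [ContinuousLinearMap.apply_apply, ContinuousLinearMap.comp_apply] at h1
      rw [h1, hBeq t ht]
      rfl
    have hBiv : IntegrableOn (fun u => fderiv ℝ (fun z => h u z) (φ s u x) (B u (y - x)))
        (Icc 0 T) :=
      (ContinuousLinearMap.apply ℝ E (y - x)).integrable_comp hBi
    have h1 : φ s t y - φ s t x - B t (y - x) = ∫ u in s..t, (h u (φ s u y) - h u (φ s u x) -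
        fderiv ℝ (fun z => h u z) (φ s u x) (B u (y - x))) := by
      rw [intervalIntegral.integral_sub
        ((intervalIntegrable_of_mem_Icc hiy hs ht).sub
          (intervalIntegrable_of_mem_Icc hix hs ht))
        (intervalIntegrable_of_mem_Icc hBiv hs ht),
        intervalIntegral.integral_sub (intervalIntegrable_of_mem_Icc hiy hs ht)
          (intervalIntegrable_of_mem_Icc hix hs ht), hBv,
        ((hφ s hs y hy).2 t ht).2, ((hφ s hs x hx).2 t ht).2]
      abel
    show ‖φ s t y - φ s t x - B t (y - x)‖ ≤ _
    rw [h1]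
    refine hS.norm_integral_le hm0 hRi.norm ?_ hs ht
    filter_upwards [ae_restrict_mem measurableSet_Icc] with u hu
    have h2 : h u (φ s u y) - h u (φ s u x) -
        fderiv ℝ (fun z => h u z) (φ s u x) (B u (y - x)) = R y u +
        fderiv ℝ (fun z => h u z) (φ s u x) (φ s u y - φ s u x - B u (y - x)) := by
      simp only [hR, map_sub]; abel
    rw [h2]
    refine (norm_add_le _ _).trans (add_le_add le_rfl ?_)
    exact (ContinuousLinearMap.le_opNorm _ _).trans (mul_le_mul
        (hB.fderiv_le _ _ (hφ.mem hs hu hx)) (hm u hu) (norm_nonneg _)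
        (mul_nonneg hB.c_pos.le (norm_nonneg _)))
  refine hasFDerivAt_iff_tendsto.2 ?_
  have hlim := (hφ.tendsto_remainder hB hS hs hx).const_mul 2
  rw [mul_zero] at hlim
  refine squeeze_zero' (Eventually.of_forall fun y => by positivity) ?_ hlim
  filter_upwards [hB.isOpen.mem_nhds hx] with y hy
  rw [integral_const_mul]
  calc _ ≤ ‖y - x‖⁻¹ * (2 * ∫ u in Icc 0 T, ‖R y u‖) :=
        mul_le_mul_of_nonneg_left (key y hy) (by positivity)
    _ = _ := by ring

theorem fderiv_spec (hφ : IsFlow T D (fun t z => h t z) φ) (hB : FieldBounds D H c L)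
    (hS : IsShort c T h) (hs : s ∈ Icc 0 T) (hx : x ∈ D) :
    ContinuousOn (fun t => fderiv ℝ (φ s t) x) (Icc 0 T) ∧
    ∀ t ∈ Icc 0 T, DifferentiableAt ℝ (φ s t) x ∧
      fderiv ℝ (φ s t) x = ContinuousLinearMap.id ℝ E +
        ∫ u in s..t, (fderiv ℝ (fun z => h u z) (φ s u x)) ∘L fderiv ℝ (φ s u) x := by
  obtain ⟨B, hBc, hBeq⟩ := hφ.exists_linearized hB hS hs hx
  have hd := fun t ht => hφ.hasFDerivAt hB hS hs hx hBc hBeq (t := t) ht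
  refine ⟨hBc.continuousOn.congr fun t ht => (hd t ht).fderiv, fun t ht =>
    ⟨(hd t ht).differentiableAt, ?_⟩⟩
  rw [(hd t ht).fderiv, hBeq t ht]
  congr 1
  refine intervalIntegral.integral_congr fun u hu => ?_
  show _ = _ ∘L fderiv ℝ (φ s u) x
  rw [(hd u (uIcc_subset_Icc hs ht hu)).fderiv]

theorem norm_fderiv_le (hφ : IsFlow T D (fun t z => h t z) φ) (hB : FieldBounds D H c L)
    (hS : IsShort c T h) (hs : s ∈ Icc 0 T) (ht : t ∈ Icc 0 T) (hx : x ∈ D) :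
    ‖fderiv ℝ (φ s t) x‖ ≤ 2 := by
  refine norm_fderiv_le_of_lip' ℝ (by norm_num) ?_
  filter_upwards [hB.isOpen.mem_nhds hx] with y hy
  exact hφ.norm_sub_le hB hS hs ht hy hx

theorem fderiv_comp_fderiv (hφ : IsFlow T D (fun t z => h t z) φ) (hB : FieldBounds D H c L)
    (hS : IsShort c T h) (hs : s ∈ Icc 0 T) (ht : t ∈ Icc 0 T) (hx : x ∈ D) :
    fderiv ℝ (φ t s) (φ s t x) ∘L fderiv ℝ (φ s t) x = ContinuousLinearMap.id ℝ E := by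
  have h1 := ((hφ.fderiv_spec hB hS ht (hφ.mem hs ht hx)).2 s hs).1
  have h2 := ((hφ.fderiv_spec hB hS hs hx).2 t ht).1
  rw [← fderiv_comp x h1 h2]
  have : φ t s ∘ φ s t =ᶠ[𝓝 x] id := by
    filter_upwards [hB.isOpen.mem_nhds hx] with y hy
    simp [hφ.comp hB hS hs ht hs hy, hφ.self hs hy]
  rw [this.fderiv_eq, fderiv_id]

theorem inverse_fderiv (hφ : IsFlow T D (fun t z => h t z) φ) (hB : FieldBounds D H c L)
    (hS : IsShort c T h) (hs : s ∈ Icc 0 T) (ht : t ∈ Icc 0 T) (hx : x ∈ D) :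
    (fderiv ℝ (φ s t) x).inverse = fderiv ℝ (φ t s) (φ s t x) := by
  have h1 := hφ.fderiv_comp_fderiv hB hS ht hs (hφ.mem hs ht hx)
  rw [hφ.comp hB hS hs ht hs hx, hφ.self hs hx] at h1
  exact ContinuousLinearMap.inverse_eq h1 (hφ.fderiv_comp_fderiv hB hS hs ht hx)

end

end IsFlow

/-! ### Dependence of the flow on the field -/

namespace IsFlow

variable {E : Type*} [NormedAddCommGroup E] [InnerProductSpace ℝ E] [CompleteSpace E]
variable {H : Type*} [NormedAddCommGroup H] [InnerProductSpace ℝ H] [CompleteSpace H]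
  [RKHS ℝ H E E]
variable {D : Set E} {c L T R Δ Λ : ℝ} {h h' : ℝ → H} {φ φ' : ℝ → ℝ → E → E} {s t t' : ℝ} {x : E}

theorem norm_sub_le_of_field (hφ : IsFlow T D (fun t z => h t z) φ)
    (hφ' : IsFlow T D (fun t z => h' t z) φ') (hB : FieldBounds D H c L) (hS : IsShort c T h)
    (hS' : IsShort c T h')
    (hΔ : ∀ᵐ u ∂((volume : Measure ℝ).restrict (Icc 0 T)), ‖h u - h' u‖ ≤ Δ)
    (hs : s ∈ Icc 0 T) (ht : t ∈ Icc 0 T) (hx : x ∈ D) :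
    ‖φ s t x - φ' s t x‖ ≤ 2 * (c * Δ * T) := by
  have hT : (0 : ℝ) ≤ T := hs.1.trans hs.2
  have hcx := (hφ s hs x hx).1
  have hcx' := (hφ' s hs x hx).1
  refine le_two_mul_of_half_bound (f := fun t => ‖φ s t x - φ' s t x‖) (S := Icc 0 T)
    (isCompact_Icc.exists_bound_of_continuousOn (hcx.sub hcx')) (fun m hm t ht => ?_) ht
  have hm0 : 0 ≤ m := (norm_nonneg _).trans (hm t ht)
  have h1 : φ s t x - φ' s t x = ∫ u in s..t, (h u (φ s u x) - h' u (φ' s u x)) := by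
    rw [intervalIntegral.integral_sub
      (intervalIntegrable_of_mem_Icc ((hφ.isCurve hs hx).integrableOn hB hS) hs ht)
      (intervalIntegrable_of_mem_Icc ((hφ'.isCurve hs hx).integrableOn hB hS') hs ht),
      ((hφ s hs x hx).2 t ht).2, ((hφ' s hs x hx).2 t ht).2]
    abel
  have h2 := hS'.norm_integral_le (F := fun u => h u (φ s u x) - h' u (φ' s u x))
    (a := fun _ => c * Δ) hm0 (integrableOn_const (by simp)) (by
      filter_upwards [ae_restrict_mem measurableSet_Icc, hΔ] with u hu hΔu
      have e1 : h u (φ s u x) - h' u (φ' s u x) = (h u - h' u) (φ s u x) +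
        (h' u (φ s u x) - h' u (φ' s u x)) := by
        rw [RKHS.coe_sub, Pi.sub_apply]; abel
      rw [e1]
      exact (norm_add_le _ _).trans (add_le_add
        ((hB.norm_le _ _).trans (mul_le_mul_of_nonneg_left hΔu hB.c_pos.le))
        ((hB.lip _ _ _).trans (mul_le_mul_of_nonneg_left (hm u hu)
          (mul_nonneg hB.c_pos.le (norm_nonneg _)))))) hs ht
  show ‖φ s t x - φ' s t x‖ ≤ _
  rw [h1]
  refine h2.trans_eq ?_
  rw [setIntegral_const]
  simp [hT]
  ring

theorem norm_fderiv_sub_le_of_field (hφ : IsFlow T D (fun t z => h t z) φ)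
    (hφ' : IsFlow T D (fun t z => h' t z) φ') (hB : FieldBounds D H c L) (hS : IsShort c T h)
    (hS' : IsShort c T h')
    (hΔ : ∀ᵐ u ∂((volume : Measure ℝ).restrict (Icc 0 T)), ‖h u - h' u‖ ≤ Δ)
    (hΛ0 : 0 ≤ Λ)
    (hΛ : ∀ᵐ u ∂((volume : Measure ℝ).restrict (Icc 0 T)), ∀ z ∈ D, ∀ z' ∈ D,
      ‖fderiv ℝ (fun y => h' u y) z - fderiv ℝ (fun y => h' u y) z'‖ ≤ Λ * ‖z - z'‖)
    (hs : s ∈ Icc 0 T) (ht : t ∈ Icc 0 T) (hx : x ∈ D) :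
    ‖fderiv ℝ (φ s t) x - fderiv ℝ (φ' s t) x‖ ≤
      2 * ((c * Δ + Λ * (2 * (c * Δ * T))) * 2 * T) := by
  have hT : (0 : ℝ) ≤ T := hs.1.trans hs.2
  obtain ⟨hc, hd⟩ := hφ.fderiv_spec hB hS hs hx
  obtain ⟨hc', hd'⟩ := hφ'.fderiv_spec hB hS' hs hx
  refine le_two_mul_of_half_bound (f := fun t => ‖fderiv ℝ (φ s t) x - fderiv ℝ (φ' s t) x‖)
    (S := Icc 0 T) (isCompact_Icc.exists_bound_of_continuousOn (hc.sub hc'))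
    (fun m hm t ht => ?_) ht
  have hm0 : 0 ≤ m := (norm_nonneg _).trans (hm t ht)
  have h1 : fderiv ℝ (φ s t) x - fderiv ℝ (φ' s t) x = ∫ u in s..t,
      ((fderiv ℝ (fun z => h u z) (φ s u x)) ∘L fderiv ℝ (φ s u) x -
      (fderiv ℝ (fun z => h' u z) (φ' s u x)) ∘L fderiv ℝ (φ' s u) x) := by
    rw [intervalIntegral.integral_sub
      (intervalIntegrable_of_mem_Icc (hφ.integrableOn_linearized hB hS hs hx hc) hs ht)
      (intervalIntegrable_of_mem_Icc (hφ'.integrableOn_linearized hB hS' hs hx hc') hs ht)]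
    rw [(hd t ht).2, (hd' t ht).2]
    abel
  have h2 := hS'.norm_integral_le (F := fun u =>
      (fderiv ℝ (fun z => h u z) (φ s u x)) ∘L fderiv ℝ (φ s u) x -
      (fderiv ℝ (fun z => h' u z) (φ' s u x)) ∘L fderiv ℝ (φ' s u) x)
    (a := fun _ => (c * Δ + Λ * (2 * (c * Δ * T))) * 2) hm0 (integrableOn_const (by simp)) (by
      filter_upwards [ae_restrict_mem measurableSet_Icc, hΔ, hΛ] with u hu hΔu hΛu
      have hq : φ s u x ∈ D := hφ.mem hs hu hx
      have hq' : φ' s u x ∈ D := hφ'.mem hs hu hx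
      have e1 : (fderiv ℝ (fun z => h u z) (φ s u x)) ∘L fderiv ℝ (φ s u) x -
          (fderiv ℝ (fun z => h' u z) (φ' s u x)) ∘L fderiv ℝ (φ' s u) x =
          (fderiv ℝ (fun z => (h u - h' u) z) (φ s u x) +
            (fderiv ℝ (fun z => h' u z) (φ s u x) - fderiv ℝ (fun z => h' u z) (φ' s u x)))
            ∘L fderiv ℝ (φ s u) x +
          (fderiv ℝ (fun z => h' u z) (φ' s u x)) ∘L
            (fderiv ℝ (φ s u) x - fderiv ℝ (φ' s u) x) := by
        rw [hB.fderiv_sub _ _ hq, ContinuousLinearMap.comp_sub, ContinuousLinearMap.add_comp,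
          ContinuousLinearMap.sub_comp, ContinuousLinearMap.sub_comp]
        abel
      rw [e1]
      refine (norm_add_le _ _).trans (add_le_add
        ((ContinuousLinearMap.opNorm_comp_le _ _).trans ?_)
        ((ContinuousLinearMap.opNorm_comp_le _ _).trans ?_))
      · refine mul_le_mul ?_ (hφ.norm_fderiv_le hB hS hs hu hx) (norm_nonneg _) ?_
        · refine (norm_add_le _ _).trans (add_le_add ?_ ?_)
          · exact (hB.fderiv_le _ _ hq).trans (mul_le_mul_of_nonneg_left hΔu hB.c_pos.le)
          · exact (hΛu _ hq _ hq').trans (mul_le_mul_of_nonneg_left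
              (hφ.norm_sub_le_of_field hφ' hB hS hS' hΔ hs hu hx) hΛ0)
        · have hΔ0 : 0 ≤ Δ := (norm_nonneg _).trans hΔu
          have := hB.c_pos
          positivity
      · exact mul_le_mul (hB.fderiv_le _ _ hq') (hm u hu) (norm_nonneg _)
          (mul_nonneg hB.c_pos.le (norm_nonneg _))) hs ht
  show ‖fderiv ℝ (φ s t) x - fderiv ℝ (φ' s t) x‖ ≤ _
  rw [h1]
  refine h2.trans_eq ?_
  rw [setIntegral_const]
  simp [hT]
  ring

theorem norm_sub_le_of_time (hφ : IsFlow T D (fun t z => h t z) φ)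
    (hB : FieldBounds D H c L) (hS : IsShort c T h) (hR : ∀ u ∈ Icc 0 T, ‖h u‖ ≤ R)
    (hs : s ∈ Icc 0 T) (ht : t ∈ Icc 0 T) (ht' : t' ∈ Icc 0 T) (hx : x ∈ D) :
    ‖φ s t x - φ s t' x‖ ≤ c * R * |t - t'| := by
  have h1 := ((hφ.isCurve hs hx).rebase hB hS hs ht').2 t ht
  have h2 : φ s t x - φ s t' x = ∫ u in t'..t, h u (φ s u x) := by
    rw [sub_eq_iff_eq_add']; exact h1
  rw [h2]
  refine intervalIntegral.norm_integral_le_of_norm_le_const fun u hu => ?_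
  have hu' : u ∈ Icc 0 T := uIcc_subset_Icc ht' ht (uIoc_subset_uIcc hu)
  exact (hB.norm_le _ _).trans (mul_le_mul_of_nonneg_left (hR u hu') hB.c_pos.le)

theorem norm_fderiv_sub_le_of_time (hφ : IsFlow T D (fun t z => h t z) φ)
    (hB : FieldBounds D H c L) (hS : IsShort c T h) (hR : ∀ u ∈ Icc 0 T, ‖h u‖ ≤ R)
    (hs : s ∈ Icc 0 T) (ht : t ∈ Icc 0 T) (ht' : t' ∈ Icc 0 T) (hx : x ∈ D) :
    ‖fderiv ℝ (φ s t) x - fderiv ℝ (φ s t') x‖ ≤ c * R * 2 * |t - t'| := by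
  obtain ⟨hc, hd⟩ := hφ.fderiv_spec hB hS hs hx
  have hi := hφ.integrableOn_linearized hB hS hs hx hc
  rw [(hd t ht).2, (hd t' ht').2, add_sub_add_left_eq_sub,
    intervalIntegral.integral_interval_sub_left
      (intervalIntegrable_of_mem_Icc hi hs ht)
      (intervalIntegrable_of_mem_Icc hi hs ht')]
  refine intervalIntegral.norm_integral_le_of_norm_le_const fun u hu => ?_
  have hu' : u ∈ Icc 0 T := uIcc_subset_Icc ht' ht (uIoc_subset_uIcc hu)
  have h1 := hB.fderiv_le (h u) _ (hφ.mem hs hu' hx)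
  have h2 := hφ.norm_fderiv_le hB hS hs hu' hx
  have h3 := mul_le_mul_of_nonneg_left (hR u hu') hB.c_pos.le
  exact (ContinuousLinearMap.opNorm_comp_le _ _).trans (mul_le_mul (h1.trans h3) h2
    (norm_nonneg _) ((norm_nonneg _).trans (h1.trans h3)))

end IsFlow

/-! ### The field generated by a transported momentum -/

section Momentum

variable {E : Type*} [NormedAddCommGroup E] [InnerProductSpace ℝ E] [CompleteSpace E]
variable {H : Type*} [NormedAddCommGroup H] [InnerProductSpace ℝ H] [CompleteSpace H]
  [RKHS ℝ H E E]
variable {Y : Type*}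

/-- The density at `y` of the field generated by the momentum `p` carried along the flow `φ` by
the particles with labels `ζ`: the particle `ζ y` sits at `q = φ_{0,t}(ζ y)` at the time `t`, and
its momentum has become `[dφ_{t,0}]_q^* p(y)`. -/
noncomputable def momentumDensity (H : Type*) [NormedAddCommGroup H] [InnerProductSpace ℝ H]
    [CompleteSpace H] [RKHS ℝ H E E] (ζ p : Y → E) (φ : ℝ → ℝ → E → E) (t : ℝ) (y : Y) : H :=
  RKHS.kerFun H (φ 0 t (ζ y))
    (ContinuousLinearMap.adjoint (fderiv ℝ (φ t 0) (φ 0 t (ζ y))) (p y))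

/-- The field generated at the time `t` by the transported momentum. -/
noncomputable def momentumField [MeasurableSpace Y] (H : Type*)
    [NormedAddCommGroup H] [InnerProductSpace ℝ H] [CompleteSpace H] [RKHS ℝ H E E]
    (ν : Measure Y) (ζ p : Y → E) (φ : ℝ → ℝ → E → E) (t : ℝ) : H :=
  ∫ y, momentumDensity H ζ p φ t y ∂ν

namespace FieldBounds

variable {D : Set E} {c L : ℝ}

/-- For `z ∈ D`, the derivative at `z` is a continuous linear function of the field. -/
noncomputable def fderivCLM (hB : FieldBounds D H c L) {z : E} (hz : z ∈ D) :
    H →L[ℝ] (E →L[ℝ] E) :=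
  LinearMap.mkContinuous
    { toFun := fun v => fderiv ℝ (fun y => v y) z
      map_add' := fun v w => by
        have : (fun y => (v + w) y) = (fun y => v y) + fun y => w y := by funext y; simp
        rw [this, _root_.fderiv_add (hB.diff v z hz) (hB.diff w z hz)]
      map_smul' := fun a v => by
        have : (fun y => (a • v) y) = a • fun y => v y := by funext y; simp
        rw [this, _root_.fderiv_const_smul (hB.diff v z hz)]
        rfl } c (fun v => hB.fderiv_le v z hz)

theorem fderivCLM_apply (hB : FieldBounds D H c L) {z : E} (hz : z ∈ D) (v : H) :
    hB.fderivCLM hz v = fderiv ℝ (fun y => v y) z := rfl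

end FieldBounds

variable {D : Set E} {c L T P : ℝ} {h h' : ℝ → H} {φ φ' : ℝ → ℝ → E → E} {t t' : ℝ}
  {ζ p : Y → E}

theorem norm_momentumDensity_le (hφ : IsFlow T D (fun t z => h t z) φ)
    (hB : FieldBounds D H c L) (hS : IsShort c T h) (ht : t ∈ Icc 0 T) {y : Y} (hy : ζ y ∈ D) :
    ‖ContinuousLinearMap.adjoint (fderiv ℝ (φ t 0) (φ 0 t (ζ y))) (p y)‖ ≤ 2 * ‖p y‖ ∧
    ‖momentumDensity H ζ p φ t y‖ ≤ c * (2 * ‖p y‖) := by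
  have h0 : (0 : ℝ) ∈ Icc 0 T := left_mem_Icc.2 (ht.1.trans ht.2)
  have h1 := hφ.norm_fderiv_le hB hS ht h0 (hφ.mem h0 ht hy)
  have h2 : ‖ContinuousLinearMap.adjoint (fderiv ℝ (φ t 0) (φ 0 t (ζ y))) (p y)‖
      ≤ 2 * ‖p y‖ := by
    refine (ContinuousLinearMap.le_opNorm _ _).trans ?_
    rw [LinearIsometryEquiv.norm_map]
    exact mul_le_mul_of_nonneg_right h1 (norm_nonneg _)
  exact ⟨h2, (ContinuousLinearMap.le_opNorm _ _).trans
    (mul_le_mul (hB.norm_kerFun_le _) h2 (norm_nonneg _) hB.c_pos.le)⟩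

variable [MeasurableSpace Y] {ν : Measure Y}

theorem norm_momentumField_le (hφ : IsFlow T D (fun t z => h t z) φ)
    (hB : FieldBounds D H c L) (hS : IsShort c T h)
    (hζD : ∀ᵐ y ∂ν, ζ y ∈ D) (hp : Integrable p ν) (hP : ∫ y, ‖p y‖ ∂ν ≤ P)
    (ht : t ∈ Icc 0 T) : ‖momentumField H ν ζ p φ t‖ ≤ 2 * c * P := by
  refine (norm_integral_le_of_norm_le ((hp.norm.const_mul 2).const_mul c) ?_).trans ?_
  · filter_upwards [hζD] with y hy
    exact (norm_momentumDensity_le hφ hB hS ht hy).2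
  · rw [integral_const_mul, integral_const_mul]
    have := mul_le_mul_of_nonneg_left hP hB.c_pos.le
    linarith

section

variable [FiniteDimensional ℝ E] [MeasurableSpace E] [BorelSpace E]

/-- Measurability in `y` needs no measurable choice of inverses, as the momentum is transported by
the derivative of the backward flow. -/
theorem integrable_momentumDensity
    (hφ : IsFlow T D (fun t z => h t z) φ)
    (hB : FieldBounds D H c L) (hS : IsShort c T h) (hζ : AEMeasurable ζ ν)
    (hζD : ∀ᵐ y ∂ν, ζ y ∈ D) (hp : Integrable p ν) (ht : t ∈ Icc 0 T) :
    Integrable (momentumDensity H ζ p φ t) ν := by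
  have h0 : (0 : ℝ) ∈ Icc 0 T := left_mem_Icc.2 (ht.1.trans ht.2)
  have : ProperSpace E := FiniteDimensional.proper_real E
  have : SecondCountableTopology E := secondCountable_of_proper
  have : ProperSpace (E →L[ℝ] E) := FiniteDimensional.proper_real _
  have : SecondCountableTopology (E →L[ℝ] E) := secondCountable_of_proper
  have hq : AEMeasurable (fun y => φ 0 t (ζ y)) ν := by
    classical
    have hc : ContinuousOn (φ 0 t) D := fun x hx =>
      ((hφ.fderiv_spec hB hS h0 hx).2 t ht).1.continuousAt.continuousWithinAt
    refine ((hc.measurable_piecewise continuousOn_const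
      hB.isOpen.measurableSet (g := fun _ => (0 : E))).comp_aemeasurable hζ).congr ?_
    filter_upwards [hζD] with y hy
    simp [hy]
  have hker : Continuous (fun x : E => RKHS.kerFun H x) := by
    refine LipschitzWith.continuous (K := ⟨c, hB.c_pos.le⟩)
      (LipschitzWith.of_dist_le_mul fun x y => ?_)
    rw [dist_eq_norm, dist_eq_norm]
    exact hB.norm_kerFun_sub_le x y
  have hA : AEStronglyMeasurable (fun y => fderiv ℝ (φ t 0) (φ 0 t (ζ y))) ν :=
    ((measurable_fderiv ℝ (φ t 0)).comp_aemeasurable hq).aestronglyMeasurable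
  have hA' : AEStronglyMeasurable (fun y => ContinuousLinearMap.adjoint
      (fderiv ℝ (φ t 0) (φ 0 t (ζ y)))) ν :=
    ContinuousLinearMap.adjoint.continuous.comp_aestronglyMeasurable hA
  have hm := isBoundedBilinearMap_apply.continuous.comp_aestronglyMeasurable
    (hA'.prodMk hp.aestronglyMeasurable)
  have hd := isBoundedBilinearMap_apply.continuous.comp_aestronglyMeasurable
    ((hker.comp_aestronglyMeasurable hq.aestronglyMeasurable).prodMk hm)
  refine Integrable.mono' ((hp.norm.const_mul 2).const_mul c) hd ?_
  filter_upwards [hζD] with y hy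
  exact (norm_momentumDensity_le hφ hB hS ht hy).2

theorem momentumField_apply (hφ : IsFlow T D (fun t z => h t z) φ)
    (hB : FieldBounds D H c L) (hS : IsShort c T h) (hζ : AEMeasurable ζ ν)
    (hζD : ∀ᵐ y ∂ν, ζ y ∈ D) (hp : Integrable p ν) (ht : t ∈ Icc 0 T) (z : E) :
    momentumField H ν ζ p φ t z = ∫ y, RKHS.kernel H z (φ 0 t (ζ y))
      (ContinuousLinearMap.adjoint (fderiv ℝ (φ t 0) (φ 0 t (ζ y))) (p y)) ∂ν := by
  have h1 := ContinuousLinearMap.integral_comp_comm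
    (ContinuousLinearMap.adjoint (RKHS.kerFun H z))
    (integrable_momentumDensity hφ hB hS hζ hζD hp ht)
  rw [RKHS.adjoint_kerFun] at h1
  rw [momentumField, ← h1]
  refine integral_congr_ae (Eventually.of_forall fun y => ?_)
  simp only [RKHS.adjoint_kerFun, momentumDensity, RKHS.kerFun_apply]

theorem norm_fderiv_momentumField_sub_le (hφ : IsFlow T D (fun t z => h t z) φ)
    (hB : FieldBounds D H c L) (hS : IsShort c T h) (hζ : AEMeasurable ζ ν)
    (hζD : ∀ᵐ y ∂ν, ζ y ∈ D) (hp : Integrable p ν) (hP : ∫ y, ‖p y‖ ∂ν ≤ P)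
    (ht : t ∈ Icc 0 T) {z z' : E} (hz : z ∈ D) (hz' : z' ∈ D) :
    ‖fderiv ℝ (fun x => momentumField H ν ζ p φ t x) z -
      fderiv ℝ (fun x => momentumField H ν ζ p φ t x) z'‖ ≤ 2 * L * P * ‖z - z'‖ := by
  have hi := integrable_momentumDensity hφ hB hS hζ hζD hp ht
  rw [← hB.fderivCLM_apply hz, ← hB.fderivCLM_apply hz', ← sub_apply, momentumField,
    ← ContinuousLinearMap.integral_comp_comm _ hi]
  refine (norm_integral_le_of_norm_le
    (((hp.norm.const_mul 2).const_mul L).mul_const ‖z - z'‖) ?_).trans ?_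
  · filter_upwards [hζD] with y hy
    rw [sub_apply, hB.fderivCLM_apply, hB.fderivCLM_apply]
    refine (hB.ker_lip _ _ z hz z' hz').trans ?_
    have := (norm_momentumDensity_le (p := p) hφ hB hS ht hy).1
    exact mul_le_mul_of_nonneg_right (mul_le_mul_of_nonneg_left this hB.L_nonneg) (norm_nonneg _)
  · rw [integral_mul_const, integral_const_mul, integral_const_mul]
    have := mul_le_mul_of_nonneg_left hP hB.L_nonneg
    exact mul_le_mul_of_nonneg_right (by linarith) (norm_nonneg _)

/-- The field depends in a Lipschitz way on the positions of the particles and on the derivative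
of the flow; inverting the derivative costs the factor `4`, as all derivatives are bounded
by `2`. -/
theorem norm_momentumField_sub_le (hφ : IsFlow T D (fun t z => h t z) φ)
    (hφ' : IsFlow T D (fun t z => h' t z) φ')
    (hB : FieldBounds D H c L) (hS : IsShort c T h) (hS' : IsShort c T h') (hζ : AEMeasurable ζ ν)
    (hζD : ∀ᵐ y ∂ν, ζ y ∈ D) (hp : Integrable p ν) (hP : ∫ y, ‖p y‖ ∂ν ≤ P)
    (ht : t ∈ Icc 0 T) (ht' : t' ∈ Icc 0 T) {a b : ℝ} (ha0 : 0 ≤ a) (hb0 : 0 ≤ b)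
    (ha : ∀ x ∈ D, ‖φ 0 t x - φ' 0 t' x‖ ≤ a)
    (hb : ∀ x ∈ D, ‖fderiv ℝ (φ 0 t) x - fderiv ℝ (φ' 0 t') x‖ ≤ b) :
    ‖momentumField H ν ζ p φ t - momentumField H ν ζ p φ' t'‖ ≤ c * (2 * a + 4 * b) * P := by
  have h0 : (0 : ℝ) ∈ Icc 0 T := left_mem_Icc.2 (ht.1.trans ht.2)
  rw [momentumField, momentumField, ← integral_sub
    (integrable_momentumDensity hφ hB hS hζ hζD hp ht)
    (integrable_momentumDensity hφ' hB hS' hζ hζD hp ht')]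
  have hc := hB.c_pos
  refine (norm_integral_le_of_norm_le (hp.norm.const_mul (c * (2 * a + 4 * b))) ?_).trans ?_
  · filter_upwards [hζD] with y hy
    set x := ζ y
    set A := fderiv ℝ (φ t 0) (φ 0 t x) with hA
    set A' := fderiv ℝ (φ' t' 0) (φ' 0 t' x) with hA'
    have hA2 : ‖A‖ ≤ 2 := hφ.norm_fderiv_le hB hS ht h0 (hφ.mem h0 ht hy)
    have hA2' : ‖A'‖ ≤ 2 := hφ'.norm_fderiv_le hB hS' ht' h0 (hφ'.mem h0 ht' hy)
    have hAB : A ∘L fderiv ℝ (φ 0 t) x = ContinuousLinearMap.id ℝ E :=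
      hφ.fderiv_comp_fderiv hB hS h0 ht hy
    have hBA : fderiv ℝ (φ' 0 t') x ∘L A' = ContinuousLinearMap.id ℝ E := by
      have h1 := hφ'.fderiv_comp_fderiv hB hS' ht' h0 (hφ'.mem h0 ht' hy)
      rwa [hφ'.comp hB hS' h0 ht' h0 hy, hφ'.self h0 hy] at h1
    have hAA : A - A' = A ∘L ((fderiv ℝ (φ' 0 t') x - fderiv ℝ (φ 0 t) x) ∘L A') := by
      rw [ContinuousLinearMap.sub_comp, ContinuousLinearMap.comp_sub, hBA,
        ← ContinuousLinearMap.comp_assoc, hAB]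
      simp
    have hAA' : ‖A - A'‖ ≤ 4 * b := by
      have h1 := hb x hy
      rw [norm_sub_rev] at h1
      rw [hAA]
      calc _ ≤ ‖A‖ * (‖fderiv ℝ (φ' 0 t') x - fderiv ℝ (φ 0 t) x‖ * ‖A'‖) :=
            (ContinuousLinearMap.opNorm_comp_le _ _).trans (mul_le_mul_of_nonneg_left
              (ContinuousLinearMap.opNorm_comp_le _ _) (norm_nonneg _))
        _ ≤ 2 * (b * 2) := by gcongr
        _ = 4 * b := by ring
    have e1 : momentumDensity H ζ p φ t y - momentumDensity H ζ p φ' t' y =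
        (RKHS.kerFun H (φ 0 t x) - RKHS.kerFun H (φ' 0 t' x)) (ContinuousLinearMap.adjoint A (p y))
        + RKHS.kerFun H (φ' 0 t' x) (ContinuousLinearMap.adjoint (A - A') (p y)) := by
      simp only [momentumDensity, map_sub, sub_apply]
      abel
    rw [e1]
    calc _ ≤ (c * a) * (2 * ‖p y‖) + c * ((4 * b) * ‖p y‖) := by
          refine (norm_add_le _ _).trans (add_le_add
            ((ContinuousLinearMap.le_opNorm _ _).trans ?_)
            ((ContinuousLinearMap.le_opNorm _ _).trans ?_))
          · refine mul_le_mul ((hB.norm_kerFun_sub_le _ _).trans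
              (mul_le_mul_of_nonneg_left (ha x hy) hc.le))
              (norm_momentumDensity_le hφ hB hS ht hy).1 (norm_nonneg _) (by positivity)
          · refine mul_le_mul (hB.norm_kerFun_le _)
              ((ContinuousLinearMap.le_opNorm _ _).trans ?_) (norm_nonneg _) hc.le
            rw [LinearIsometryEquiv.norm_map]
            exact mul_le_mul_of_nonneg_right hAA' (norm_nonneg _)
      _ = _ := by ring
  · rw [integral_const_mul]
    exact mul_le_mul_of_nonneg_left hP (by positivity)

theorem continuousOn_momentumField {R : ℝ} (hφ : IsFlow T D (fun t z => h t z) φ)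
    (hB : FieldBounds D H c L) (hS : IsShort c T h) (hR : ∀ u ∈ Icc 0 T, ‖h u‖ ≤ R)
    (hζ : AEMeasurable ζ ν)
    (hζD : ∀ᵐ y ∂ν, ζ y ∈ D) (hp : Integrable p ν) :
    ContinuousOn (momentumField H ν ζ p φ) (Icc 0 T) := by
  rcases (Icc 0 T).eq_empty_or_nonempty with he | ⟨u₀, hu₀⟩
  · rw [he]; exact continuousOn_empty _
  have h0 : (0 : ℝ) ∈ Icc 0 T := left_mem_Icc.2 (hu₀.1.trans hu₀.2)
  have hR0 : 0 ≤ R := (norm_nonneg _).trans (hR _ h0)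
  have hc := hB.c_pos
  have hP0 : 0 ≤ ∫ y, ‖p y‖ ∂ν := integral_nonneg fun _ => norm_nonneg _
  refine LipschitzOnWith.continuousOn
    (K := ⟨c * (2 * (c * R) + 4 * (c * R * 2)) * ∫ y, ‖p y‖ ∂ν, by positivity⟩)
    (LipschitzOnWith.of_dist_le_mul fun t ht t' ht' => ?_)
  rw [dist_eq_norm, Real.dist_eq]
  refine (norm_momentumField_sub_le hφ hφ hB hS hS hζ hζD hp le_rfl ht ht'
    (a := c * R * |t - t'|) (b := c * R * 2 * |t - t'|) (by positivity) (by positivity)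
    (fun x hx => hφ.norm_sub_le_of_time hB hS hR h0 ht ht' hx)
    (fun x hx => hφ.norm_fderiv_sub_le_of_time hB hS hR h0 ht ht' hx)).trans_eq ?_
  change _ = (c * (2 * (c * R) + 4 * (c * R * 2)) * ∫ y, ‖p y‖ ∂ν) * |t - t'|
  ring

/-- The Lipschitz estimate for the map that sends a field to the field generated by the momentum
transported along its flow. Its constant tends to `0` with `T`. -/
theorem norm_momentumField_sub_le_of_field {Δ Λ : ℝ} (hφ : IsFlow T D (fun t z => h t z) φ)
    (hφ' : IsFlow T D (fun t z => h' t z) φ')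
    (hB : FieldBounds D H c L) (hS : IsShort c T h) (hS' : IsShort c T h') (hζ : AEMeasurable ζ ν)
    (hζD : ∀ᵐ y ∂ν, ζ y ∈ D) (hp : Integrable p ν) (hP : ∫ y, ‖p y‖ ∂ν ≤ P) (hΔ0 : 0 ≤ Δ)
    (hΔ : ∀ᵐ u ∂((volume : Measure ℝ).restrict (Icc 0 T)), ‖h u - h' u‖ ≤ Δ)
    (hΛ0 : 0 ≤ Λ)
    (hΛ : ∀ᵐ u ∂((volume : Measure ℝ).restrict (Icc 0 T)), ∀ z ∈ D, ∀ z' ∈ D,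
      ‖fderiv ℝ (fun y => h' u y) z - fderiv ℝ (fun y => h' u y) z'‖ ≤ Λ * ‖z - z'‖)
    (ht : t ∈ Icc 0 T) :
    ‖momentumField H ν ζ p φ t - momentumField H ν ζ p φ' t‖ ≤
      c ^ 2 * P * T * (20 + 32 * Λ * T) * Δ := by
  have h0 : (0 : ℝ) ∈ Icc 0 T := left_mem_Icc.2 (ht.1.trans ht.2)
  have hT : (0 : ℝ) ≤ T := ht.1.trans ht.2
  have hc := hB.c_pos
  refine (norm_momentumField_sub_le hφ hφ' hB hS hS' hζ hζD hp hP ht ht (by positivity)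
    (by positivity) (fun x hx => hφ.norm_sub_le_of_field hφ' hB hS hS' hΔ h0 ht hx)
    (fun x hx => hφ.norm_fderiv_sub_le_of_field hφ' hB hS hS' hΔ hΛ0 hΛ h0 ht hx)).trans_eq ?_
  ring

end

end Momentum

/-! ### Evolution of a transported momentum on a short time interval -/

section Evolution

/-- A priori bound: if `‖h t‖ ≤ R` holds as long as `h` is short on `[0, t]`, then `h` is short on
`[0, T]`. Otherwise `∫₀ᵗ c * ‖h u‖ du = 1 / 2` for some `t`, but up to this time the integrand is at
most `c * R`, so that the integral is at most `1 / 4`. -/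
theorem isShort_of_bound {H : Type*} [NormedAddCommGroup H] {c T : ℝ} {h : ℝ → H}
    (hc : 0 < c) (hT : 0 ≤ T) {R : ℝ} (hR : 0 ≤ R)
    (hRT : c * R * T ≤ 1 / 4) (hh : IntegrableOn h (Icc 0 T))
    (hbd : ∀ᵐ u ∂((volume : Measure ℝ).restrict (Icc 0 T)), IsShort c u h → ‖h u‖ ≤ R) :
    IsShort c T h := by
  refine ⟨hh, ?_⟩
  by_contra! hlt
  have hi : IntegrableOn (fun u => c * ‖h u‖) (Icc 0 T) := Integrable.const_mul hh.norm c
  have hG : ∀ t, 0 ≤ t → ∫ u in (0 : ℝ)..t, c * ‖h u‖ = ∫ u in Icc 0 t, c * ‖h u‖ := fun t ht => by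
    rw [intervalIntegral.integral_of_le ht, integral_Icc_eq_integral_Ioc]
  have hcont : ContinuousOn (fun t => ∫ u in (0 : ℝ)..t, c * ‖h u‖) (Icc 0 T) := by
    have := intervalIntegral.continuousOn_primitive_interval' (a := 0)
      (intervalIntegrable_of_mem_Icc hi (left_mem_Icc.2 hT) (right_mem_Icc.2 hT))
      left_mem_uIcc
    rwa [uIcc_of_le hT] at this
  obtain ⟨t, ht, hGt⟩ : (1 / 2 : ℝ) ∈ (fun t => ∫ u in (0 : ℝ)..t, c * ‖h u‖) '' Icc 0 T := by
    refine intermediate_value_Icc hT hcont ⟨?_, ?_⟩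
    · simp
    · rw [hG T hT]; exact hlt.le
  simp only [hG t ht.1] at hGt
  have hsub : Icc 0 t ⊆ Icc 0 T := Icc_subset_Icc_right ht.2
  have hSt : IsShort c t h := ⟨hh.mono_set hsub, hGt.le⟩
  have h1 : ∫ u in Icc 0 t, c * ‖h u‖ ≤ ∫ _u in Icc 0 t, c * R := by
    refine integral_mono_ae (hi.mono_set hsub) (integrableOn_const (by simp)) ?_
    filter_upwards [ae_restrict_mem measurableSet_Icc,
      ae_restrict_of_ae_restrict_of_subset hsub hbd] with u hu hbu
    exact mul_le_mul_of_nonneg_left (hbu (hSt.mono hc hu.2)) hc.le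
  rw [hGt, setIntegral_const] at h1
  simp only [measureReal_def, Real.volume_Icc, sub_zero, ENNReal.toReal_ofReal ht.1,
    smul_eq_mul] at h1
  have h2 : t * (c * R) ≤ T * (c * R) := mul_le_mul_of_nonneg_right ht.2 (by positivity)
  linarith

theorem integrableOn_L2path {H : Type*} [NormedAddCommGroup H] {T : ℝ} (f : L2path T H) :
    IntegrableOn f (Icc 0 T) :=
  (Lp.memLp f).integrable (by norm_num)

variable {E : Type*} [NormedAddCommGroup E] [InnerProductSpace ℝ E] [CompleteSpace E]
variable {H : Type*} [NormedAddCommGroup H] [InnerProductSpace ℝ H] [CompleteSpace H]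
  [RKHS ℝ H E E]
variable {Y : Type*} [MeasurableSpace Y]
variable {D : Set E} {c L T P : ℝ} {h h' : ℝ → H} {φ φ' : ℝ → ℝ → E → E} {t t' : ℝ}
  {ν : Measure Y} {ζ p : Y → E}

/-- The length `T` of the time interval is short for momenta of total mass at most `P`: the fields
that they generate, of norm at most `2 * c * P` and with derivatives of Lipschitz constant at most
`2 * L * P`, are strictly shorter than `IsShort` asks for, and the evolution map is a
contraction. -/
structure IsShortTime (c L P T : ℝ) : Prop where
  pos : 0 < T
  P_nonneg : 0 ≤ P
  mul_le : c * (2 * c * P) * T ≤ 1 / 4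
  contracting : c ^ 2 * P * T * (20 + 32 * (2 * L * P) * T) ≤ 1 / 2

theorem exists_isShortTime (hc : 0 < c) (hL : 0 ≤ L) (hP : 0 ≤ P) :
    ∃ T₀ : ℝ, 0 < T₀ ∧ ∀ T, 0 < T → T ≤ T₀ → IsShortTime c L P T := by
  -- for `T ≤ 1` the left hand side of the contraction condition is at most `T * (K - 1) / 2`, and
  -- that of the bound on the fields is at most a tenth of this
  set K := 1 + 2 * (c ^ 2 * P * (20 + 64 * L * P)) with hK
  have h1 : 0 ≤ c ^ 2 * P := by positivity
  have h2 : 0 ≤ c ^ 2 * P * (64 * L * P) := by positivity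
  have hK0 : 0 < K := by positivity
  refine ⟨min 1 (1 / K), lt_min one_pos (by positivity), fun T hT hT0 => ?_⟩
  have hT1 : T ≤ 1 := hT0.trans (min_le_left _ _)
  have hTK : T * K ≤ 1 := by
    have := hT0.trans (min_le_right _ _)
    rwa [le_div_iff₀ hK0] at this
  have hTK' : T * (2 * (c ^ 2 * P * (20 + 64 * L * P))) ≤ 1 := by
    rw [hK, mul_add, mul_one] at hTK; linarith
  have h3 : 0 ≤ T * (c ^ 2 * P * (64 * L * P)) := by positivity
  refine ⟨hT, hP, ?_, ?_⟩
  · have h4 : 0 ≤ T * (c ^ 2 * P) := by positivity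
    linarith [mul_assoc T (c ^ 2 * P) (64 * L * P)]
  · have h5 : T * (c ^ 2 * P * (64 * L * P)) * T ≤ T * (c ^ 2 * P * (64 * L * P)) * 1 :=
      mul_le_mul_of_nonneg_left hT1 h3
    linarith

/-- The field `h` with flow `φ` is generated by the momentum that it transports, at almost every
time up to which it is short. The restriction to such times makes it possible to bring the given
equations to this form before any bound on `h` is known: only then the derivative of the flow is
known to exist and to be invertible. -/
def IsEvolution (D : Set E) (c T : ℝ) (ν : Measure Y) (ζ p : Y → E) (h : ℝ → H)
    (φ : ℝ → ℝ → E → E) : Prop :=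
  IsFlow T D (fun t z => h t z) φ ∧ ∀ᵐ t ∂((volume : Measure ℝ).restrict (Icc 0 T)),
    IsShort c t h → h t = momentumField H ν ζ p φ t

theorem IsEvolution.isShort (he : IsEvolution D c T ν ζ p h φ) (hB : FieldBounds D H c L)
    (hT : IsShortTime c L P T) (hh : IntegrableOn h (Icc 0 T))
    (hζD : ∀ᵐ y ∂ν, ζ y ∈ D) (hp : Integrable p ν) (hP : ∫ y, ‖p y‖ ∂ν ≤ P) :
    IsShort c T h := by
  have hc := hB.c_pos
  have hP0 := hT.P_nonneg
  refine isShort_of_bound hc hT.pos.le (R := 2 * c * P) (by positivity) hT.mul_le hh ?_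
  filter_upwards [he.2, ae_restrict_mem measurableSet_Icc] with u hu huT hS
  rw [hu hS]
  exact norm_momentumField_le (he.1.mono huT.2) hB hS hζD hp hP (right_mem_Icc.2 huT.1)

variable [FiniteDimensional ℝ E] [MeasurableSpace E] [BorelSpace E]

/-- Two evolutions of the same momentum agree: if their fields differ by at most `Δ` then they
differ by at most `Δ / 2`. -/
theorem IsEvolution.ae_eq (he : IsEvolution D c T ν ζ p h φ) (he' : IsEvolution D c T ν ζ p h' φ')
    (hB : FieldBounds D H c L)
    (hT : IsShortTime c L P T) (hh : IntegrableOn h (Icc 0 T)) (hh' : IntegrableOn h' (Icc 0 T))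
    (hζ : AEMeasurable ζ ν)
    (hζD : ∀ᵐ y ∂ν, ζ y ∈ D) (hp : Integrable p ν) (hP : ∫ y, ‖p y‖ ∂ν ≤ P) :
    ∀ᵐ t ∂((volume : Measure ℝ).restrict (Icc 0 T)), h t = h' t := by
  have hc := hB.c_pos
  have hP0 := hT.P_nonneg
  have hL := hB.L_nonneg
  have hS := he.isShort hB hT hh hζD hp hP
  have hS' := he'.isShort hB hT hh' hζD hp hP
  have heq : ∀ᵐ t ∂((volume : Measure ℝ).restrict (Icc 0 T)), h t = momentumField H ν ζ p φ t := by
    filter_upwards [he.2, ae_restrict_mem measurableSet_Icc] with u hu huT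
    exact hu (hS.mono hc huT.2)
  have heq' : ∀ᵐ t ∂((volume : Measure ℝ).restrict (Icc 0 T)),
      h' t = momentumField H ν ζ p φ' t := by
    filter_upwards [he'.2, ae_restrict_mem measurableSet_Icc] with u hu huT
    exact hu (hS'.mono hc huT.2)
  have key : ∀ k : ℕ, ∀ᵐ t ∂((volume : Measure ℝ).restrict (Icc 0 T)),
      ‖h t - h' t‖ ≤ (4 * c * P) * (1 / 2) ^ k := by
    intro k
    induction k with
    | zero =>
      filter_upwards [heq, heq', ae_restrict_mem measurableSet_Icc] with t h1 h2 ht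
      have h3 := norm_momentumField_le he.1 hB hS hζD hp hP ht
      have h4 := norm_momentumField_le he'.1 hB hS' hζD hp hP ht
      rw [← h1] at h3
      rw [← h2] at h4
      rw [pow_zero, mul_one]
      exact (norm_sub_le _ _).trans (by linarith)
    | succ k ih =>
      filter_upwards [heq, heq', ae_restrict_mem measurableSet_Icc] with t h1 h2 ht
      have h3 := norm_momentumField_sub_le_of_field (Λ := 2 * L * P) he.1 he'.1 hB hS hS' hζ hζD hp
        hP (by positivity) ih (by positivity) (by
          filter_upwards [heq', ae_restrict_mem measurableSet_Icc] with u hu huT z hz z' hz'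
          rw [hu]
          exact norm_fderiv_momentumField_sub_le he'.1 hB hS' hζ hζD hp hP huT hz hz') ht
      rw [h1, h2]
      refine h3.trans ((mul_le_mul_of_nonneg_right hT.contracting (by positivity)).trans_eq ?_)
      ring
  filter_upwards [ae_all_iff.2 key] with t ht
  have hlim : Tendsto (fun k : ℕ => (4 * c * P) * (1 / 2 : ℝ) ^ k) atTop (𝓝 0) := by
    have := (tendsto_pow_atTop_nhds_zero_of_lt_one (r := (1 / 2 : ℝ)) (by norm_num)
      (by norm_num)).const_mul (4 * c * P)
    rwa [mul_zero] at this
  have := ge_of_tendsto' hlim ht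
  exact sub_eq_zero.1 (norm_le_zero_iff.1 this)

/-- Existence of the evolution, by the contraction principle in the complete space of continuous
paths in `H` which satisfy the bounds of the fields generated by momenta of mass at most `P`. -/
theorem exists_isEvolution (hB : FieldBounds D H c L) (hT : IsShortTime c L P T)
    (hζ : AEMeasurable ζ ν) (hζD : ∀ᵐ y ∂ν, ζ y ∈ D) (hp : Integrable p ν)
    (hP : ∫ y, ‖p y‖ ∂ν ≤ P) :
    ∃ (h : ℝ → H) (φ : ℝ → ℝ → E → E), Continuous h ∧ (∀ t, ‖h t‖ ≤ 2 * c * P) ∧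
      IsShort c T h ∧ IsFlow T D (fun t z => h t z) φ ∧
      ∀ t ∈ Icc 0 T, h t = momentumField H ν ζ p φ t := by
  have hc := hB.c_pos
  have hP0 := hT.P_nonneg
  have hL := hB.L_nonneg
  have hT0 := hT.pos.le
  have h0T : (0 : ℝ) ∈ Icc 0 T := left_mem_Icc.2 hT0
  let K : Set C(Icc (0 : ℝ) T, H) := {γ | (∀ t, ‖γ t‖ ≤ 2 * c * P) ∧ ∀ t, ∀ z ∈ D, ∀ z' ∈ D,
    ‖fderiv ℝ (fun y => γ t y) z - fderiv ℝ (fun y => γ t y) z'‖ ≤ 2 * L * P * ‖z - z'‖}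
  have hKc : IsClosed K := by
    have : K = (⋂ t, {γ : C(Icc (0 : ℝ) T, H) | ‖γ t‖ ≤ 2 * c * P}) ∩
        ⋂ (t) (z) (hz : z ∈ D) (z') (hz' : z' ∈ D), {γ : C(Icc (0 : ℝ) T, H) |
          ‖hB.fderivCLM hz (γ t) - hB.fderivCLM hz' (γ t)‖ ≤ 2 * L * P * ‖z - z'‖} := by
      ext γ; simp [K, hB.fderivCLM_apply]
    rw [this]
    refine (isClosed_iInter fun t => isClosed_le (continuous_eval_const t).norm
      continuous_const).inter ?_
    refine isClosed_iInter fun t => isClosed_iInter fun z => isClosed_iInter fun hz =>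
      isClosed_iInter fun z' => isClosed_iInter fun hz' => isClosed_le ?_ continuous_const
    exact (((hB.fderivCLM hz).continuous.comp (continuous_eval_const t)).sub
      ((hB.fderivCLM hz').continuous.comp (continuous_eval_const t))).norm
  have hshort : ∀ γ ∈ K, IsShort c T (IccExtend hT0 γ) := fun γ hγ => by
    have hcγ : Continuous (IccExtend hT0 γ) := γ.continuous.Icc_extend'
    refine ⟨hcγ.integrableOn_Icc, ?_⟩
    have h1 : ∫ u in Icc 0 T, c * ‖IccExtend hT0 γ u‖ ≤ ∫ _u in Icc 0 T, c * (2 * c * P) :=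
      integral_mono (continuous_const.mul hcγ.norm).integrableOn_Icc
        (integrableOn_const (by simp))
        fun u => mul_le_mul_of_nonneg_left (hγ.1 _) hc.le
    rw [setIntegral_const] at h1
    simp only [measureReal_def, Real.volume_Icc, sub_zero, ENNReal.toReal_ofReal hT0,
      smul_eq_mul] at h1
    linarith [hT.mul_le]
  have hstep : ∀ γ ∈ K, ∃ (γ' : C(Icc (0 : ℝ) T, H)) (φ : ℝ → ℝ → E → E), γ' ∈ K ∧
      IsFlow T D (fun t z => IccExtend hT0 γ t z) φ ∧
      ∀ t : Icc (0 : ℝ) T, γ' t = momentumField H ν ζ p φ t := fun γ hγ => by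
    obtain ⟨φ, hφ⟩ := exists_isFlow hB (hshort γ hγ)
    have hcm := continuousOn_momentumField hφ hB (hshort γ hγ) (R := 2 * c * P)
      (fun u _ => hγ.1 _) hζ hζD hp
    refine ⟨⟨_, continuousOn_iff_continuous_domRestrict.1 hcm⟩, φ, ⟨fun t => ?_,
      fun t z hz z' hz' => ?_⟩, hφ, fun t => rfl⟩
    · exact norm_momentumField_le hφ hB (hshort γ hγ) hζD hp hP t.2
    · exact norm_fderiv_momentumField_sub_le hφ hB (hshort γ hγ) hζ hζD hp hP t.2 hz hz'
  choose! Ψ Φ hΨK hΦ hΨ using hstep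
  have hmaps : MapsTo Ψ K K := fun γ hγ => hΨK γ hγ
  have hcontr : ContractingWith (1 / 2 : ℝ≥0) (hmaps.restrict Ψ K K) := by
    refine ⟨by norm_num, LipschitzWith.of_dist_le_mul fun γ γ' => ?_⟩
    change dist (Ψ γ) (Ψ γ') ≤ ((1 / 2 : ℝ≥0) : ℝ) * dist (γ : C(Icc (0 : ℝ) T, H)) γ'
    have h2 : ((1 / 2 : ℝ≥0) : ℝ) = 1 / 2 := by norm_num
    rw [h2, ContinuousMap.dist_le (by positivity)]
    intro t
    rw [dist_eq_norm, hΨ γ γ.2, hΨ γ' γ'.2]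
    refine (norm_momentumField_sub_le_of_field (Λ := 2 * L * P)
      (Δ := dist (γ : C(Icc (0 : ℝ) T, H)) γ') (hΦ γ γ.2) (hΦ γ' γ'.2) hB
      (hshort γ γ.2) (hshort γ' γ'.2) hζ hζD hp hP dist_nonneg (Eventually.of_forall fun u => ?_)
      (by positivity) (Eventually.of_forall fun u z hz z' hz' => γ'.2.2 _ z hz z' hz') t.2).trans
      (mul_le_mul_of_nonneg_right hT.contracting dist_nonneg)
    rw [← dist_eq_norm]
    exact ContinuousMap.dist_apply_le_dist _
  have h0K : (0 : C(Icc (0 : ℝ) T, H)) ∈ K := by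
    refine ⟨fun t => by simp; positivity, fun t z _ z' _ => ?_⟩
    simp
    positivity
  obtain ⟨γ, hγK, hγ, -⟩ := hcontr.exists_fixedPoint' hKc.isComplete hmaps h0K (edist_ne_top _ _)
  refine ⟨IccExtend hT0 γ, Φ γ, γ.continuous.Icc_extend', fun t => hγK.1 _, hshort γ hγK,
    hΦ γ hγK, fun t ht => ?_⟩
  rw [← hΨ γ hγK ⟨t, ht⟩, hγ.eq, IccExtend_of_mem _ _ ht]

/-- The evolution as an element of `L²([0, T], H)`. -/
theorem exists_L2path_evolution (hB : FieldBounds D H c L) (hT : IsShortTime c L P T)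
    (hζ : AEMeasurable ζ ν) (hζD : ∀ᵐ y ∂ν, ζ y ∈ D) (hp : Integrable p ν)
    (hP : ∫ y, ‖p y‖ ∂ν ≤ P) :
    ∃ (f : L2path T H) (φ : ℝ → ℝ → E → E), IsShort c T f ∧ IsFlow T D (fun t z => f t z) φ ∧
      ∀ᵐ t ∂((volume : Measure ℝ).restrict (Icc 0 T)), f t = momentumField H ν ζ p φ t := by
  obtain ⟨h, φ, hc, hbd, hS, hφ, heq⟩ := exists_isEvolution hB hT hζ hζD hp hP
  have hm : MemLp h 2 ((volume : Measure ℝ).restrict (Icc 0 T)) :=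
    MemLp.of_bound hc.aestronglyMeasurable _ (Eventually.of_forall hbd)
  have hf := hm.coeFn_toLp
  refine ⟨hm.toLp h, φ, ⟨?_, ?_⟩, hφ.congr_ae (hf.mono fun t ht => ht.symm), ?_⟩
  · exact Integrable.congr hS.integrableOn hf.symm
  · refine (integral_congr_ae ?_).trans_le hS.integral_le
    filter_upwards [hf] with t ht
    rw [ht]
  · filter_upwards [hf, ae_restrict_mem measurableSet_Icc] with t ht htT
    rw [ht, heq t htT]

end Evolution

/-! ### The two equations of the system as evolutions of a momentum -/

section Deformation

theorem measurableEmbedding_inl {α β : Type*} [MeasurableSpace α] [MeasurableSpace β] :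
    MeasurableEmbedding (Sum.inl : α → α ⊕ β) :=
  ⟨Sum.inl_injective, measurable_inl, fun _ hs => measurableSet_inl_image.2 hs⟩

theorem measurableEmbedding_inr {α β : Type*} [MeasurableSpace α] [MeasurableSpace β] :
    MeasurableEmbedding (Sum.inr : β → α ⊕ β) :=
  ⟨Sum.inr_injective, measurable_inr, fun _ hs => measurableSet_inr_image.2 hs⟩

variable {n : ℕ} {M : Set (Rn n)} {V : Type*} [NormedAddCommGroup V] [InnerProductSpace ℝ V]
  [CompleteSpace V] [RKHS ℝ V (Rn n) (Rn n)]
variable {c L T : ℝ} {v : ℝ → V} {φ : ℝ → ℝ → Rn n → Rn n} {I₀ : Rn n → ℝ} {s t : ℝ}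

/-- The particles that carry the momentum of the deformation: the points of `M`, with Lebesgue
measure, and the points of the jump set, with Hausdorff measure. -/
noncomputable def deformationMeasure (M : Set (Rn n)) (I₀ : Rn n → ℝ) :
    Measure (Rn n ⊕ Rn n) :=
  (volume.restrict M).map Sum.inl +
    ((Measure.euclideanHausdorffMeasure (n - 1) : Measure (Rn n)).restrict (jumpSet M I₀)).map
      Sum.inr

/-- The momentum density `(p_a, p_b) / λ` on the particles of `deformationMeasure`. -/
noncomputable def deformationMomentum (lam : ℝ) (pa pb : Rn n → Rn n) : Rn n ⊕ Rn n → Rn n :=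
  Sum.elim (fun x => lam⁻¹ • pa x) (fun x => lam⁻¹ • pb x)

theorem measurable_sumElim_id : Measurable (Sum.elim id id : Rn n ⊕ Rn n → Rn n) :=
  measurable_id.sumElim measurable_id

theorem ae_jumpSet_mem (hM : IsOpen M) (I₀ : Rn n → ℝ) :
    ∀ᵐ x ∂((Measure.euclideanHausdorffMeasure (n - 1) : Measure (Rn n)).restrict
      (jumpSet M I₀)), x ∈ M :=
  ae_mono (Measure.restrict_mono (fun _ hx => hx.1) le_rfl) (ae_restrict_mem hM.measurableSet)

theorem ae_deformationMeasure (hM : IsOpen M) :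
    ∀ᵐ y ∂(deformationMeasure M I₀), (Sum.elim id id y : Rn n) ∈ M := by
  rw [deformationMeasure, ae_add_measure_iff, measurableEmbedding_inl.ae_map_iff,
    measurableEmbedding_inr.ae_map_iff]
  exact ⟨ae_restrict_mem hM.measurableSet, ae_jumpSet_mem hM I₀⟩

theorem integrable_deformationMomentum {pa pb : Rn n → Rn n} (hpa : IntegrableOn pa M)
    (hpb : IntegrableOn pb (jumpSet M I₀) (Measure.euclideanHausdorffMeasure (n - 1)))
    (lam : ℝ) : Integrable (deformationMomentum lam pa pb) (deformationMeasure M I₀) := by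
  rw [deformationMeasure, integrable_add_measure, measurableEmbedding_inl.integrable_map_iff,
    measurableEmbedding_inr.integrable_map_iff]
  exact ⟨hpa.smul lam⁻¹, hpb.smul lam⁻¹⟩

/-- Up to the factor `λ`, the field generated by `deformationMomentum` is the right hand side of the
equation of the deformation field, because `[dφ_{t,0}]` at `φ_{0,t}(x)` is `[dφ_{0,t}]ₓ⁻¹`. -/
theorem momentumField_deformation_apply (hφ : IsFlow T M (fun t x => v t x) φ)
    (hB : FieldBounds M V c L) (hS : IsShort c T v) {lam : ℝ} (hlam : 0 < lam)
    {pa pb : Rn n → Rn n} (hpa : IntegrableOn pa M)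
    (hpb : IntegrableOn pb (jumpSet M I₀) (Measure.euclideanHausdorffMeasure (n - 1)))
    (ht : t ∈ Icc 0 T) (z : Rn n) :
    lam • momentumField V (deformationMeasure M I₀) (Sum.elim id id)
        (deformationMomentum lam pa pb) φ t z =
      (∫ x in M, RKHS.kernel V z (φ 0 t x) (pushMomentum (φ 0 t) x (pa x))) +
      ∫ x in jumpSet M I₀, RKHS.kernel V z (φ 0 t x) (pushMomentum (φ 0 t) x (pb x))
        ∂(Measure.euclideanHausdorffMeasure (n - 1) : Measure (Rn n)) := by
  have h0 : (0 : ℝ) ∈ Icc 0 T := left_mem_Icc.2 (ht.1.trans ht.2)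
  have hζ := (measurable_sumElim_id (n := n)).aemeasurable (μ := deformationMeasure M I₀)
  have hζD := ae_deformationMeasure (I₀ := I₀) hB.isOpen
  have hp := integrable_deformationMomentum hpa hpb lam
  have hi := (ContinuousLinearMap.adjoint (RKHS.kerFun V z)).integrable_comp
    (integrable_momentumDensity hφ hB hS hζ hζD hp ht)
  simp only [RKHS.adjoint_kerFun, momentumDensity, RKHS.kerFun_apply] at hi
  rw [deformationMeasure, integrable_add_measure] at hi
  rw [momentumField_apply hφ hB hS hζ hζD hp ht, deformationMeasure,
    integral_add_measure hi.1 hi.2, measurableEmbedding_inl.integral_map,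
    measurableEmbedding_inr.integral_map, smul_add, ← integral_smul, ← integral_smul]
  have hpush : ∀ (x : Rn n) (m : Rn n), x ∈ M →
      lam • RKHS.kernel V z (φ 0 t x) (ContinuousLinearMap.adjoint
        (fderiv ℝ (φ t 0) (φ 0 t x)) (lam⁻¹ • m)) =
      RKHS.kernel V z (φ 0 t x) (pushMomentum (φ 0 t) x m) := fun x m hx => by
    rw [pushMomentum, hφ.inverse_fderiv hB hS h0 ht hx, map_smul, map_smul, smul_smul,
      mul_inv_cancel₀ hlam.ne', one_smul]
  congr 1
  · refine integral_congr_ae ?_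
    filter_upwards [ae_restrict_mem hB.isOpen.measurableSet] with x hx
    exact hpush x (pa x) hx
  · refine integral_congr_ae ?_
    filter_upwards [ae_jumpSet_mem hB.isOpen I₀] with x hx
    exact hpush x (pb x) hx

/-- A flow, being invertible with differentiable inverse, pulls back functions that are measurable
up to null sets to such functions. -/
theorem aemeasurable_comp_flow (hφ : IsFlow T M (fun t x => v t x) φ)
    (hB : FieldBounds M V c L) (hS : IsShort c T v) (hs : s ∈ Icc 0 T) (ht : t ∈ Icc 0 T)
    {f : Rn n → ℝ} (hf : AEMeasurable f (volume.restrict M)) :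
    AEMeasurable (fun x => f (φ s t x)) (volume.restrict M) := by
  have hφm : AEMeasurable (φ s t) (volume.restrict M) := by
    have hc : ContinuousOn (φ s t) M := fun x hx =>
      ((hφ.fderiv_spec hB hS hs hx).2 t ht).1.continuousAt.continuousWithinAt
    exact hc.aemeasurable hB.isOpen.measurableSet
  have hac : (volume.restrict M).map (φ s t) ≪ volume.restrict M := by
    refine Measure.AbsolutelyContinuous.mk fun N hN hN0 => ?_
    rw [Measure.map_apply_of_aemeasurable hφm hN, Measure.restrict_apply' hB.isOpen.measurableSet]
    rw [Measure.restrict_apply' hB.isOpen.measurableSet] at hN0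
    have himg : volume (φ t s '' (N ∩ M)) = 0 :=
      addHaar_image_eq_zero_of_differentiableOn_of_addHaar_eq_zero volume (fun x hx =>
        ((hφ.fderiv_spec hB hS ht hx.2).2 s hs).1.differentiableWithinAt) hN0
    refine measure_mono_null (fun x hx => ?_) himg
    exact ⟨φ s t x, ⟨hx.1, hφ.mem hs ht hx.2⟩, by
      rw [hφ.comp hB hS hs ht hs hx.2, hφ.self hs hx.2]⟩
  exact (hf.mono_ac hac).comp_aemeasurable hφm

end Deformation

section Contrast

variable {S : Type*} [NormedAddCommGroup S] [InnerProductSpace ℝ S] [CompleteSpace S]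
  [RKHS ℝ S ℝ ℝ]
variable {Y : Type*} [MeasurableSpace Y] {ν : Measure Y}
variable {c L T t : ℝ} {σ : ℝ → S} {η : ℝ → ℝ → ℝ → ℝ} {ζ pc : Y → ℝ}

theorem adjoint_real_apply (A : ℝ →L[ℝ] ℝ) (r : ℝ) :
    ContinuousLinearMap.adjoint A r = r * A 1 := by
  have := ContinuousLinearMap.adjoint_inner_left A 1 r
  simpa [mul_comm] using this

/-- In dimension one the transpose of `[dη_{t,0}]` is multiplication by the derivative, so that the
equation of the contrast field has the common form as it stands. -/
theorem momentumField_contrast_apply (hη : IsFlow T univ (fun t x => σ t x) η)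
    (hB : FieldBounds univ S c L) (hS : IsShort c T σ) {β : ℝ} (hβ : 0 < β)
    (hζ : AEMeasurable ζ ν) (hpc : Integrable pc ν) (ht : t ∈ Icc 0 T) (z : ℝ) :
    β * momentumField S ν ζ (fun y => β⁻¹ * pc y) η t z =
      ∫ y, RKHS.kernel S z (η 0 t (ζ y)) (pc y * deriv (η t 0) (η 0 t (ζ y))) ∂ν := by
  rw [momentumField_apply hη hB hS hζ (Eventually.of_forall fun _ => mem_univ _)
    (hpc.const_mul β⁻¹) ht, ← integral_const_mul]
  refine integral_congr_ae (Eventually.of_forall fun y => ?_)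
  simp only [adjoint_real_apply, fderiv_apply_one_eq_deriv]
  rw [mul_assoc, ← smul_eq_mul (a := β⁻¹), map_smul, smul_eq_mul, mul_inv_cancel_left₀ hβ.ne']

end Contrast

namespace IsSolution

variable {n : ℕ} {M : Set (Rn n)} {V S : Type*}
  [NormedAddCommGroup V] [InnerProductSpace ℝ V] [CompleteSpace V] [RKHS ℝ V (Rn n) (Rn n)]
  [NormedAddCommGroup S] [InnerProductSpace ℝ S] [CompleteSpace S] [RKHS ℝ S ℝ ℝ]
  {lam β T τ c L c' L' : ℝ} {I₀ : Rn n → ℝ} {pa pb : Rn n → Rn n} {pc : Rn n → ℝ}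
  {v : L2path T V} {s : L2path T S} {φ : ℝ → ℝ → Rn n → Rn n} {η : ℝ → ℝ → ℝ → ℝ}

theorem isEvolution_deformation (h : IsSolution M lam β I₀ pa pb pc T τ v s φ η)
    (hB : FieldBounds M V c L) (hlam : 0 < lam) (hpa : IntegrableOn pa M)
    (hpb : IntegrableOn pb (jumpSet M I₀) (Measure.euclideanHausdorffMeasure (n - 1))) :
    IsEvolution M c T (deformationMeasure M I₀) (Sum.elim id id)
      (deformationMomentum lam pa pb) v φ := by
  refine ⟨h.flow_v, ?_⟩
  filter_upwards [h.eq_v, ae_restrict_mem measurableSet_Icc] with t ht htT hSt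
  refine RKHS.ext fun z => ?_
  have h1 := momentumField_deformation_apply (h.flow_v.mono htT.2) hB hSt hlam hpa hpb
    (right_mem_Icc.2 htT.1) z
  rw [← ht z] at h1
  exact (smul_right_injective _ hlam.ne' h1).symm

theorem isEvolution_contrast (h : IsSolution M lam β I₀ pa pb pc T τ v s φ η)
    (hB : FieldBounds univ S c L) (hβ : 0 < β)
    (hζ : AEMeasurable (fun y => I₀ (φ τ 0 y)) (volume.restrict M)) (hpc : IntegrableOn pc M) :
    IsEvolution univ c T (volume.restrict M) (fun y => I₀ (φ τ 0 y)) (fun y => β⁻¹ * pc y)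
      s η := by
  refine ⟨h.flow_s, ?_⟩
  filter_upwards [h.eq_s, ae_restrict_mem measurableSet_Icc] with t ht htT hSt
  refine RKHS.ext fun z => ?_
  have h1 := momentumField_contrast_apply (h.flow_s.mono htT.2) hB hSt hβ hζ hpc
    (right_mem_Icc.2 htT.1) z
  rw [← ht z] at h1
  exact (mul_left_cancel₀ hβ.ne' h1).symm

end IsSolution

end ImageMatching

open ImageMatching
theorem mainTheorem6 {n : ℕ} (hn : 1 ≤ n) {M : Set (Rn n)}
    (hMo : IsOpen M) (hMb : Bornology.IsBounded M)
    {V S : Type*}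
    [NormedAddCommGroup V] [InnerProductSpace ℝ V] [CompleteSpace V] [RKHS ℝ V (Rn n) (Rn n)]
    [NormedAddCommGroup S] [InnerProductSpace ℝ S] [CompleteSpace S] [RKHS ℝ S ℝ ℝ]
    (hV : IsC1FieldSpace M V) (hS : IsC1FieldSpace univ S)
    (hkV : HasLipschitzDerivKernel M V) (hkS : HasLipschitzDerivKernel univ S)
    {lam β : ℝ} (hlam : 0 < lam) (hβ : 0 < β)
    {I₀ : Rn n → ℝ} (hI₀ : IsImage M I₀)
    {pa pb : Rn n → Rn n} {pc : Rn n → ℝ}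
    (hpa : IntegrableOn pa M)
    (hpb : IntegrableOn pb (jumpSet M I₀) (Measure.euclideanHausdorffMeasure (n - 1)))
    (hpc : IntegrableOn pc M) :
    ∃ T₀ : ℝ, 0 < T₀ ∧ ∀ T : ℝ, 0 < T → T ≤ T₀ → ∀ τ ∈ Icc 0 T,
      (∃ (v : L2path T V) (s : L2path T S) (φ : ℝ → ℝ → Rn n → Rn n) (η : ℝ → ℝ → ℝ → ℝ),
        IsSolution M lam β I₀ pa pb pc T τ v s φ η) ∧
      (∀ (v v' : L2path T V) (s s' : L2path T S)
        (φ φ' : ℝ → ℝ → Rn n → Rn n) (η η' : ℝ → ℝ → ℝ → ℝ),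
        IsSolution M lam β I₀ pa pb pc T τ v s φ η →
        IsSolution M lam β I₀ pa pb pc T τ v' s' φ' η' →
        v = v' ∧ s = s' ∧
          ∀ t₁ ∈ Icc 0 T, ∀ t₂ ∈ Icc 0 T,
            (∀ x ∈ M, φ t₁ t₂ x = φ' t₁ t₂ x) ∧ ∀ z : ℝ, η t₁ t₂ z = η' t₁ t₂ z) := by
  obtain ⟨c, L, hBV⟩ := exists_fieldBounds hMo hV hkV
  obtain ⟨c', L', hBS⟩ := exists_fieldBounds isOpen_univ hS hkS
  have hζV := (measurable_sumElim_id (n := n)).aemeasurable (μ := deformationMeasure M I₀)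
  have hζM := ae_deformationMeasure (I₀ := I₀) hMo
  have hp := integrable_deformationMomentum hpa hpb lam
  have hpS : Integrable (fun y => β⁻¹ * pc y) (volume.restrict M) := hpc.const_mul β⁻¹
  have hI : AEMeasurable I₀ (volume.restrict M) := hI₀.1.1.aestronglyMeasurable.aemeasurable
  obtain ⟨T₁, hT₁, hshort₁⟩ := exists_isShortTime hBV.c_pos hBV.L_nonneg
    (integral_nonneg fun y => norm_nonneg (deformationMomentum lam pa pb y) :
      0 ≤ ∫ y, ‖deformationMomentum lam pa pb y‖ ∂(deformationMeasure M I₀))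
  obtain ⟨T₂, hT₂, hshort₂⟩ := exists_isShortTime hBS.c_pos hBS.L_nonneg
    (integral_nonneg fun y => norm_nonneg (β⁻¹ * pc y) : 0 ≤ ∫ y in M, ‖β⁻¹ * pc y‖)
  refine ⟨min T₁ T₂, lt_min hT₁ hT₂, fun T hT hTle τ hτ => ?_⟩
  have hTV := hshort₁ T hT (hTle.trans (min_le_left _ _))
  have hTS := hshort₂ T hT (hTle.trans (min_le_right _ _))
  have h0 : (0 : ℝ) ∈ Icc 0 T := left_mem_Icc.2 hT.le
  have huniv : ∀ ζ : Rn n → ℝ, ∀ᵐ y ∂((volume : Measure (Rn n)).restrict M), ζ y ∈ univ :=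
    fun ζ => Eventually.of_forall fun _ => mem_univ _
  constructor
  · obtain ⟨v, φ, hvS, hφ, hv⟩ := exists_L2path_evolution hBV hTV hζV hζM hp le_rfl
    have hζ := aemeasurable_comp_flow hφ hBV hvS hτ h0 hI
    obtain ⟨s, η, hsS, hη, hs⟩ := exists_L2path_evolution hBS hTS hζ (huniv _) hpS le_rfl
    refine ⟨v, s, φ, η, hη, ?_, hφ, ?_⟩
    · filter_upwards [hs, ae_restrict_mem measurableSet_Icc] with t ht htT z
      rw [ht]
      exact momentumField_contrast_apply hη hBS hsS hβ hζ hpc htT z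
    · filter_upwards [hv, ae_restrict_mem measurableSet_Icc] with t ht htT z
      rw [ht]
      exact momentumField_deformation_apply hφ hBV hvS hlam hpa hpb htT z
  · intro v v' s s' φ φ' η η' h h'
    have he := h.isEvolution_deformation hBV hlam hpa hpb
    have he' := h'.isEvolution_deformation hBV hlam hpa hpb
    have hv : v = v' := Lp.ext (he.ae_eq he' hBV hTV (integrableOn_L2path v)
      (integrableOn_L2path v') hζV hζM hp le_rfl)
    subst hv
    have hvS := he.isShort hBV hTV (integrableOn_L2path v) hζM hp le_rfl
    have hφ : ∀ t₁ ∈ Icc 0 T, ∀ t₂ ∈ Icc 0 T, ∀ x ∈ M, φ t₁ t₂ x = φ' t₁ t₂ x :=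
      fun t₁ h₁ t₂ h₂ x hx => h.flow_v.eq_of_isFlow h'.flow_v hBV hvS h₁ h₂ hx
    have hζ := aemeasurable_comp_flow h.flow_v hBV hvS hτ h0 hI
    have hζ' := aemeasurable_comp_flow h'.flow_v hBV hvS hτ h0 hI
    have hes := h.isEvolution_contrast hBS hβ hζ hpc
    have hes' := h'.isEvolution_contrast hBS hβ hζ' hpc
    -- both second equations transport the same momentum, as the labels agree on `M`
    have hes'' : IsEvolution univ c' T (volume.restrict M) (fun y => I₀ (φ τ 0 y))
        (fun y => β⁻¹ * pc y) s' η' := by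
      refine ⟨hes'.1, ?_⟩
      filter_upwards [hes'.2] with t ht hSt
      rw [ht hSt]
      refine integral_congr_ae ?_
      filter_upwards [ae_restrict_mem hMo.measurableSet] with y hy
      simp only [momentumDensity, hφ τ hτ 0 h0 y hy]
    have hs : s = s' := Lp.ext (hes.ae_eq hes'' hBS hTS (integrableOn_L2path s)
      (integrableOn_L2path s') hζ (huniv _) hpS le_rfl)
    subst hs
    have hsS := hes.isShort hBS hTS (integrableOn_L2path s) (huniv _) hpS le_rfl
    exact ⟨rfl, rfl, fun t₁ h₁ t₂ h₂ => ⟨hφ t₁ h₁ t₂ h₂, fun z =>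
      h.flow_s.eq_of_isFlow h'.flow_s hBS hsS h₁ h₂ (mem_univ z)⟩⟩
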